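/- Let $n\ge 3$ and $m\ge 1$ be integers. Let $V=\{a\in\mathbb R^n : a_1+\dots+a_n=0\}$ with the standard inner product, and for $i\neq j$ and $k\in\mathbb Z$ let $H_{\epsilon_i-\epsilon_j,k}=\{v\in V : v_i-v_j=k\}$. A root $\alpha=\epsilon_i-\epsilon_j$ is positive if $i<j$, and then $s_\alpha\in S_n$ is the transposition $(i\,j)$. Put $\theta=\epsilon_1-\epsilon_n$. Let $\widetilde S_n$ be the affine symmetric group, i.e. the group of permutations $\phi$ of $\mathbb Z$ with $\phi(x+n)=\phi(x)+n$ for all $x$ and $\sum_{i=0}^{n-1}\phi(i)=\sum_{i=0}^{n-1}i$. It is generated by $s_1,\dots,s_{n-1}$, where $s_i$ interchanges $i-1$ and $i$ (and their translates by multiples of $n$), and $s_0$, which interchanges $-1$ and $0$ (and their translates). It acts on $V$ so that $s_i$ is the reflection in $H_{\epsilon_i-\epsilon_{i+1},0}$ for $1\le i\le n-1$ and $s_0$ is the reflection in $H_{\theta,1}$; the subgroup $\langle s_1,\dots,s_{n-1}\rangle$ is identified with $S_n$, acting by permuting coordinates. Let $\ell$ denote word length with respect to the generators $s_0,\dots,s_{n-1}$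 on $\widetilde S_n$, respectively $s_1,\dots,s_{n-1}$ on $S_n$. Let $A_0=\{v\in V : v_1\ge v_2\ge\dots\ge v_n,\ v_1-v_n\le 1\}$. The alcoves are the sets $wA_0$, $w\in\widetilde S_n$; an alcove is dominant if it is contained in $\{v\in V : v_1\ge\dots\ge v_n\}$. A wall of an alcove is a hyperplane $H_{\alpha,k}$ that contains one of its facets; a floor is a wall that does not contain the origin and separates the alcove from the origin. The regions of the $m$-Shi arrangement are the connected components of the complement in $V$ of the union of the hyperplanes $H_{\alpha,k}$ with $\alpha$ a positive root and $-m<k\le m$. The alcove $wA_0$ is $m$-minimal if $\ell(w)$ is minimal among all $\ell(u)$ such that $uA_0$ lies (up to its boundary) in the same region as $wA_0$. **Theorem.** Let $w\in\widetilde S_n$ be such that $wA_0$ is dominant and $m$-minimal. Let $X\subseteq S_n$ be the set of transpositions $s_\alpha$, with $\alpha$ a positive root, such that $H_{\alpha,m}$ is a floor of $wA_0$. Let $\rho\in S_n$. Then $\rho wA_0$ is $m$-minimal if and only if $\ell(\rho x)>\ell(\rho)$ for all $x\in X$. -/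

import Mathlib

open scoped Pointwise

noncomputable section

namespace ShiArr

/-! ### The affine symmetric group -/

/-- `n`-periodicity of a permutation of `ℤ`. -/
def IsPeriodicPerm (n : ℕ) (φ : Equiv.Perm ℤ) : Prop :=
  ∀ x : ℤ, φ (x + n) = φ x + n

theorem periodic_add_mul {n : ℕ} {φ : Equiv.Perm ℤ} (hφ : IsPeriodicPerm n φ) (x q : ℤ) :
    φ (x + q * n) = φ x + q * n := by
  induction q using Int.induction_on with
  | zero => simp
  | succ k ih =>
    have h := hφ (x + k * n)
    rw [ih] at h
    rw [show x + ((k : ℤ) + 1) * n = x + k * n + n by ring, h]; ring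
  | pred k ih =>
    have h := hφ (x + (-(k : ℤ) - 1) * n)
    rw [show x + (-(k : ℤ) - 1) * n + n = x + -(k : ℤ) * n by ring, ih] at h
    linarith

theorem isPeriodicPerm_inv {n : ℕ} {φ : Equiv.Perm ℤ} (hφ : IsPeriodicPerm n φ) :
    IsPeriodicPerm n φ⁻¹ := by
  intro x
  apply φ.injective
  rw [hφ]
  simp

/-- The sum of an `n`-periodic function over a window does not depend on the window. -/
theorem sum_window {n : ℕ} [NeZero n] {M : Type*} [AddCommMonoid M] {φ : Equiv.Perm ℤ}
    (hφ : IsPeriodicPerm n φ) (h : ℤ → M) (hh : ∀ x q : ℤ, h (x + q * n) = h x) :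
    ∑ i : Fin n, h (φ (i : ℕ)) = ∑ i : Fin n, h (i : ℕ) := by
  let d := Int.divModEquiv n
  have key : ∀ x : ℤ, (((d x).2 : ℕ) : ℤ) + (d x).1 * n = x := by
    intro x
    have := d.symm_apply_apply x
    rw [Int.divModEquiv_symm_apply] at this
    linarith
  have inj : Function.Injective fun i : Fin n => (d (φ (i : ℕ))).2 := by
    intro i j hij
    simp only at hij
    have hi := key (φ (i : ℕ))
    have hj := key (φ (j : ℕ))
    rw [hij] at hi
    have e : φ (i : ℕ) = φ ((j : ℕ) + ((d (φ (i : ℕ))).1 - (d (φ (j : ℕ))).1) * n) := by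
      rw [periodic_add_mul hφ]; linarith
    have e' := φ.injective e
    generalize (d (φ (i : ℕ))).1 - (d (φ (j : ℕ))).1 = q at e'
    have h1 : ((i : ℕ) : ℤ) % n = ((j : ℕ) : ℤ) % n := by rw [e']; simp
    rw [Int.emod_eq_of_lt (by positivity) (by exact_mod_cast i.2),
      Int.emod_eq_of_lt (by positivity) (by exact_mod_cast j.2)] at h1
    exact Fin.ext (by exact_mod_cast h1)
  have bij := Finite.injective_iff_bijective.1 inj
  rw [← Equiv.sum_comp (Equiv.ofBijective _ bij) (fun i : Fin n => h (i : ℕ))]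
  refine Finset.sum_congr rfl fun i _ => ?_
  simp only [Equiv.ofBijective_apply]
  conv_lhs => rw [← key (φ (i : ℕ))]
  rw [hh]

theorem sum_mul {n : ℕ} [NeZero n] {φ ψ : Equiv.Perm ℤ} (hφ : IsPeriodicPerm n φ)
    (hψ : IsPeriodicPerm n ψ) :
    ∑ i : Fin n, φ (ψ (i : ℕ)) + ∑ i : Fin n, ((i : ℕ) : ℤ) =
      ∑ i : Fin n, φ (i : ℕ) + ∑ i : Fin n, ψ (i : ℕ) := by
  have h := sum_window hψ (fun x => φ x - x) (fun x q => by rw [periodic_add_mul hφ]; ring)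
  simp only [Finset.sum_sub_distrib] at h
  linarith

/-- The affine symmetric group `S̃ₙ`: the permutations `φ` of `ℤ` with `φ (x + n) = φ x + n` and
`φ 0 + ⋯ + φ (n - 1) = 0 + ⋯ + (n - 1)`. -/
def AffineSymm (n : ℕ) [NeZero n] : Subgroup (Equiv.Perm ℤ) where
  carrier := {φ | (∀ x : ℤ, φ (x + n) = φ x + n) ∧
    ∑ i : Fin n, φ (i : ℕ) = ∑ i : Fin n, ((i : ℕ) : ℤ)}
  mul_mem' := by
    rintro φ ψ ⟨hφ, sφ⟩ ⟨hψ, sψ⟩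
    refine ⟨fun x => ?_, ?_⟩
    · rw [Equiv.Perm.mul_apply, hψ, hφ, Equiv.Perm.mul_apply]
    · have := sum_mul (n := n) hφ hψ
      simp only [Equiv.Perm.mul_apply]
      linarith
  one_mem' := by simp
  inv_mem' := by
    rintro φ ⟨hφ, sφ⟩
    have hi := isPeriodicPerm_inv (n := n) hφ
    refine ⟨hi, ?_⟩
    have := sum_mul (n := n) hφ hi
    simp only [show ∀ x, φ (φ⁻¹ x) = x from φ.apply_symm_apply] at this
    linarith

/-- The embedding of `Sₙ`, acting on the positions `0, …, n - 1`, as the subgroup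
`G = ⟨s₁, …, sₙ₋₁⟩` of `S̃ₙ`: `ρ` is sent to `q n + r ↦ q n + ρ r` (`0 ≤ r < n`). -/
def finEmbed (n : ℕ) [NeZero n] : Equiv.Perm (Fin n) →* AffineSymm n where
  toFun ρ := ⟨(Int.divModEquiv n).trans
      (((Equiv.refl ℤ).prodCongr ρ).trans (Int.divModEquiv n).symm), by
    have hd : ∀ (q : ℤ) (r : Fin n), Int.divModEquiv n ((r : ℕ) + q * n) = (q, r) := by
      intro q r
      rw [show ((r : ℕ) : ℤ) + q * n = (Int.divModEquiv n).symm (q, r) by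
        rw [Int.divModEquiv_symm_apply]; ring, Equiv.apply_symm_apply]
    refine ⟨fun x => ?_, ?_⟩
    · obtain ⟨⟨q, r⟩, rfl⟩ := (Int.divModEquiv n).symm.surjective x
      have h : (Int.divModEquiv n).symm (q, r) + (n : ℤ) = (r : ℕ) + (q + 1) * n := by
        rw [Int.divModEquiv_symm_apply]; ring
      rw [h]
      simp only [Equiv.trans_apply]
      rw [hd, Equiv.apply_symm_apply]
      simp only [Equiv.prodCongr_apply, Prod.map, Equiv.refl_apply, Int.divModEquiv_symm_apply]
      ring
    · have h : ∀ i : Fin n, Int.divModEquiv n ((i : ℕ) : ℤ) = (0, i) := by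
        intro i; simpa using hd 0 i
      simp only [Equiv.trans_apply, h, Equiv.prodCongr_apply, Prod.map, Equiv.refl_apply,
        Int.divModEquiv_symm_apply, zero_mul, zero_add]
      exact Equiv.sum_comp ρ fun i : Fin n => ((i : ℕ) : ℤ)⟩
  map_one' := by
    apply Subtype.ext
    ext x
    exact (Int.divModEquiv n).symm_apply_apply x
  map_mul' ρ τ := by
    apply Subtype.ext
    ext x
    simp only [Subgroup.coe_mul, Equiv.Perm.mul_apply, Equiv.trans_apply, Equiv.apply_symm_apply]
    rfl

/-- Word length of a group element with respect to a set of generators. -/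
def wordLength {Γ : Type*} [Group Γ] (S : Set Γ) (g : Γ) : ℕ :=
  sInf {k : ℕ | ∃ l : List Γ, l.length = k ∧ (∀ s ∈ l, s ∈ S) ∧ l.prod = g}

/-- The simple transpositions of `Sₙ`. -/
def finSimple (n : ℕ) : Set (Equiv.Perm (Fin n)) :=
  {s | ∃ i j : Fin n, (j : ℕ) = i + 1 ∧ s = Equiv.swap i j}

/-- The length function of `Sₙ`. -/
def finLength {n : ℕ} (ρ : Equiv.Perm (Fin n)) : ℕ := wordLength (finSimple n) ρ

/-- The simple reflections of `S̃ₙ`: `s₁, …, sₙ₋₁`, the images of the simple transpositions, and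
`s₀`, the element with `n`-window `(-1, 1, 2, …, n - 2, n)`. -/
def affSimple (n : ℕ) [NeZero n] : Set (AffineSymm n) :=
  {s | (∃ t ∈ finSimple n, s = finEmbed n t) ∨
    ((s : Equiv.Perm ℤ) 0 = -1 ∧ (s : Equiv.Perm ℤ) (n - 1) = n ∧
      ∀ x : ℤ, 0 < x → x < n - 1 → (s : Equiv.Perm ℤ) x = x)}

/-- The length function of `S̃ₙ`. -/
def affLength {n : ℕ} [NeZero n] (w : AffineSymm n) : ℕ := wordLength (affSimple n) w

/-! ### The space `V`, roots and hyperplanes -/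

/-- `V`: the vectors of `ℝⁿ` whose coordinates sum to `0`. -/
def V (n : ℕ) : Submodule ℝ (EuclideanSpace ℝ (Fin n)) where
  carrier := {v | ∑ i, v i = 0}
  add_mem' := by
    intro a b ha hb
    change ∑ i, _ = (0 : ℝ)
    change ∑ i, _ = (0 : ℝ) at ha
    change ∑ i, _ = (0 : ℝ) at hb
    simp [Finset.sum_add_distrib, ha, hb]
  zero_mem' := by simp
  smul_mem' := by
    intro c a ha
    change ∑ i, _ = (0 : ℝ)
    change ∑ i, _ = (0 : ℝ) at ha
    simp [← Finset.mul_sum, ha]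

/-- The vector `ε_i - ε_j`; it is a positive root if `i < j`. -/
def root {n : ℕ} (i j : Fin n) : V n :=
  ⟨EuclideanSpace.single i 1 - EuclideanSpace.single j 1, by
    change ∑ k, _ = (0 : ℝ)
    simp [Finset.sum_sub_distrib]⟩

/-- The hyperplane `H_{α,k}`. -/
def hyperplane {n : ℕ} (α : V n) (k : ℤ) : Set (V n) := {v | inner ℝ v α = (k : ℝ)}

/-- The closed half-space `H_{α,k}⁺`. -/
def halfPos {n : ℕ} (α : V n) (k : ℤ) : Set (V n) := {v | (k : ℝ) ≤ inner ℝ v α}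

/-- The closed half-space `H_{α,k}⁻`. -/
def halfNeg {n : ℕ} (α : V n) (k : ℤ) : Set (V n) := {v | inner ℝ v α ≤ (k : ℝ)}

/-- The simple roots `ε_i - ε_{i+1}`. -/
def simpleRoots (n : ℕ) : Set (V n) := {α | ∃ i j : Fin n, (j : ℕ) = i + 1 ∧ α = root i j}

/-- The highest root: first basis vector minus last basis vector. -/
def highestRoot (n : ℕ) [NeZero n] : V n :=
  root 0 ⟨n - 1, Nat.sub_lt (Nat.pos_of_neZero n) one_pos⟩

/-- The (closed) dominant chamber. -/
def dominantChamber (n : ℕ) : Set (V n) := ⋂ α ∈ simpleRoots n, halfPos α 0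

/-- The (closed) fundamental alcove `A₀`. -/
def A₀ (n : ℕ) [NeZero n] : Set (V n) := dominantChamber n ∩ halfNeg (highestRoot n) 1

/-! ### The action of `S̃ₙ` on `V` -/

/-- The extension of `(v_0, …, v_{n-1})` to all integer positions by `v_{x+n} = v_x - 1`. -/
def extend {n : ℕ} [NeZero n] (v : EuclideanSpace ℝ (Fin n)) (x : ℤ) : ℝ :=
  v (Int.divModEquiv n x).2 - ((Int.divModEquiv n x).1 : ℝ)

theorem extend_add {n : ℕ} [NeZero n] (v : EuclideanSpace ℝ (Fin n)) (r : Fin n) (q : ℤ) :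
    extend v ((r : ℕ) + q * n) = v r - q := by
  have : Int.divModEquiv n (((r : ℕ) : ℤ) + q * n) = (q, r) := by
    rw [show ((r : ℕ) : ℤ) + q * n = (Int.divModEquiv n).symm (q, r) by
      rw [Int.divModEquiv_symm_apply]; ring, Equiv.apply_symm_apply]
  simp [extend, this]

theorem extend_add_mul {n : ℕ} [NeZero n] (v : EuclideanSpace ℝ (Fin n)) (x q : ℤ) :
    extend v (x + q * n) = extend v x - q := by
  obtain ⟨⟨p, r⟩, rfl⟩ := (Int.divModEquiv n).symm.surjective x
  rw [Int.divModEquiv_symm_apply]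
  rw [show p * (n : ℤ) + ((r : ℕ) : ℤ) + q * n = (r : ℕ) + (p + q) * n by ring,
    show p * (n : ℤ) + ((r : ℕ) : ℤ) = (r : ℕ) + p * n by ring, extend_add, extend_add]
  push_cast; ring

/-- The action of `S̃ₙ` on coordinate vectors: `w` permutes the positions of the extended
sequence, so the entry of `w • v` at position `i` is the extended entry of `v` at `w⁻¹ i`. -/
def actVec {n : ℕ} [NeZero n] (w : AffineSymm n) (v : EuclideanSpace ℝ (Fin n)) :
    EuclideanSpace ℝ (Fin n) :=
  WithLp.toLp 2 fun i => extend v ((w⁻¹ : AffineSymm n).1 ((i : ℕ) : ℤ))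

theorem extend_actVec {n : ℕ} [NeZero n] (w : AffineSymm n) (v : EuclideanSpace ℝ (Fin n))
    (x : ℤ) : extend (actVec w v) x = extend v ((w⁻¹ : AffineSymm n).1 x) := by
  obtain ⟨⟨p, r⟩, rfl⟩ := (Int.divModEquiv n).symm.surjective x
  rw [Int.divModEquiv_symm_apply]
  rw [show p * (n : ℤ) + ((r : ℕ) : ℤ) = (r : ℕ) + p * n by ring, extend_add,
    periodic_add_mul (w⁻¹).2.1, extend_add_mul]
  rfl

theorem sum_actVec {n : ℕ} [NeZero n] (w : AffineSymm n) (v : EuclideanSpace ℝ (Fin n)) :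
    ∑ i, actVec w v i = ∑ i, v i := by
  have hn : (n : ℝ) ≠ 0 := by exact_mod_cast NeZero.ne n
  have h := sum_window (n := n) (φ := (w⁻¹ : AffineSymm n).1) (w⁻¹).2.1
    (fun x => extend v x + (x : ℝ) / n) (fun x q => by
      rw [extend_add_mul]; push_cast; field_simp; ring)
  have hs : (∑ i : Fin n, (((w⁻¹ : AffineSymm n).1 ((i : ℕ) : ℤ) : ℤ) : ℝ)) =
      ∑ i : Fin n, (((i : ℕ) : ℤ) : ℝ) := by exact_mod_cast (w⁻¹).2.2
  simp only [Finset.sum_add_distrib, ← Finset.sum_div] at h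
  rw [hs] at h
  have h' := add_right_cancel h
  calc ∑ i, actVec w v i = ∑ i : Fin n, extend v ((w⁻¹ : AffineSymm n).1 ((i : ℕ) : ℤ)) := rfl
    _ = ∑ i : Fin n, extend v ((i : ℕ) : ℤ) := h'
    _ = ∑ i, v i := Finset.sum_congr rfl fun i _ => by simpa using extend_add v i 0

/-- The action of `S̃ₙ` on `V`. -/
instance (n : ℕ) [NeZero n] : MulAction (AffineSymm n) (V n) where
  smul w v := ⟨actVec w v.1, (sum_actVec w v.1).trans v.2⟩
  one_smul v := by
    apply Subtype.ext
    ext i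
    change extend v.1 ((1⁻¹ : AffineSymm n).1 ((i : ℕ) : ℤ)) = v.1 i
    simpa using extend_add v.1 i 0
  mul_smul u w v := by
    apply Subtype.ext
    ext i
    change extend v.1 (((u * w)⁻¹ : AffineSymm n).1 ((i : ℕ) : ℤ)) =
      extend (actVec w v.1) ((u⁻¹ : AffineSymm n).1 ((i : ℕ) : ℤ))
    rw [extend_actVec, mul_inv_rev]
    rfl

/-- `Sₙ` acts by permuting the coordinates. -/
theorem finEmbed_smul_apply {n : ℕ} [NeZero n] (ρ : Equiv.Perm (Fin n)) (v : V n) (i : Fin n) :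
    (finEmbed n ρ • v).1 i = v.1 (ρ⁻¹ i) := by
  change extend v.1 (((finEmbed n ρ)⁻¹ : AffineSymm n).1 ((i : ℕ) : ℤ)) = _
  rw [← map_inv]
  have h : Int.divModEquiv n ((i : ℕ) : ℤ) = (0, i) := by
    rw [show ((i : ℕ) : ℤ) = (Int.divModEquiv n).symm (0, i) by
      rw [Int.divModEquiv_symm_apply]; ring, Equiv.apply_symm_apply]
  have h2 : (finEmbed n ρ⁻¹).1 ((i : ℕ) : ℤ) = ((ρ⁻¹ i : Fin n) : ℕ) := by
    simp [finEmbed, h]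
  rw [h2]
  simpa using extend_add v.1 (ρ⁻¹ i) 0

/-- `s₀` acts by `(a₁, …, aₙ) ↦ (aₙ + 1, a₂, …, aₙ₋₁, a₁ - 1)`. -/
theorem affine_reflection_smul (n : ℕ) [NeZero n] (hn : 2 ≤ n) (s : AffineSymm n) (h0 : s.1 0 = -1)
    (h1 : s.1 (n - 1) = n) 
    (h2 : ∀ x : ℤ, 0 < x → x < n - 1 → s.1 x = x)
    (v : V n) : (s • v).1 ⟨0, by omega⟩ = v.1 ⟨n - 1, by omega⟩ + 1 ∧
      (s • v).1 ⟨n - 1, by omega⟩ = v.1 ⟨0, by omega⟩ - 1 ∧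
      ∀ i : Fin n, 0 < (i:ℕ) → (i:ℕ) < n - 1 → (s • v).1 i = v.1 i := by
  have e0 : (s⁻¹).1 0 = -1 := by
    apply s.1.injective
    have := s.2.1 (-1)
    rw [show (-1:ℤ) + n = n - 1 by ring, h1] at this
    exact (s.1.apply_symm_apply 0).trans (by linarith)
  have e1 : (s⁻¹).1 (n - 1) = n := by
    apply s.1.injective
    have := s.2.1 0
    rw [zero_add, h0] at this
    exact (s.1.apply_symm_apply _).trans (by linarith)
  have e2 : ∀ x : ℤ, 0 < x → x < n - 1 → (s⁻¹).1 x = x := by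
    intro x a b
    apply s.1.injective
    exact (s.1.apply_symm_apply _).trans (h2 x a b).symm
  refine ⟨?_, ?_, ?_⟩
  · change ShiArr.extend v.1 ((s⁻¹).1 ((0:ℕ):ℤ)) = _
    rw [Nat.cast_zero, e0]
    have := extend_add v.1 ⟨n - 1, by omega⟩ (-1)
    rw [show (((n - 1 : ℕ)):ℤ) + -1 * n = -1 by push_cast [show 1 ≤ n by omega]; ring] at this
    rw [this]; push_cast; ring
  · change ShiArr.extend v.1 ((s⁻¹).1 ((n - 1:ℕ):ℤ)) = _
    rw [show ((n - 1:ℕ):ℤ) = n - 1 by push_cast [show 1 ≤ n by omega]; ring, e1]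
    have := extend_add v.1 ⟨0, by omega⟩ 1
    simpa using this
  · intro i a b
    change ShiArr.extend v.1 ((s⁻¹).1 ((i:ℕ):ℤ)) = _
    rw [e2 _ (by omega) (by omega)]
    simpa using extend_add v.1 i 0

/-! ### Regions, walls, floors and minimal alcoves -/

/-- The `m`-Shi arrangement: the hyperplanes `H_{α,k}` with `α > 0` and `-m < k ≤ m`. -/
def shiArrangement (n m : ℕ) : Set (Set (V n)) :=
  {H | ∃ i j : Fin n, i < j ∧ ∃ k : ℤ, -(m : ℤ) < k ∧ k ≤ m ∧ H = hyperplane (root i j) k}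

/-- The regions of an arrangement: the connected components of its complement. -/
def regions {n : ℕ} (𝓗 : Set (Set (V n))) : Set (Set (V n)) :=
  {R | ∃ v ∈ (⋃₀ 𝓗)ᶜ, R = connectedComponentIn (⋃₀ 𝓗)ᶜ v}

/-- The alcove `w A₀` is dominant. -/
def IsDominant {n : ℕ} [NeZero n] (w : AffineSymm n) : Prop :=
  w • A₀ n ⊆ dominantChamber n

/-- The alcove `w A₀` is `m`-minimal: it has minimal length among the alcoves in its region of the
`m`-Shi arrangement. As `A₀` is closed and regions are open, an alcove lies in a region when its
interior does. -/
def IsMinimalAlcove {n : ℕ} [NeZero n] (m : ℕ) (w : AffineSymm n) : Prop :=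
  ∃ R ∈ regions (shiArrangement n m), interior (w • A₀ n) ⊆ R ∧
    ∀ u : AffineSymm n, interior (u • A₀ n) ⊆ R → affLength w ≤ affLength u

/-- `H_{α,k}` is a wall of the (closed) alcove `A`: it is the affine hull of a facet of `A`. -/
def IsWall {n : ℕ} (α : V n) (k : ℤ) (A : Set (V n)) : Prop :=
  (affineSpan ℝ (A ∩ hyperplane α k) : Set (V n)) = hyperplane α k

/-- `H_{α,k}` is a floor of the alcove `A`: a wall that does not contain the origin and separates
`A` from the origin. -/
def IsFloor {n : ℕ} (α : V n) (k : ℤ) (A : Set (V n)) : Prop :=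
  IsWall α k A ∧ (0 : V n) ∉ hyperplane α k ∧
    ((A ⊆ halfPos α k ∧ (0 : V n) ∈ halfNeg α k) ∨ (A ⊆ halfNeg α k ∧ (0 : V n) ∈ halfPos α k))

/-- The set of transpositions `s_α`, `α > 0`, such that `H_{α,m}` is a floor of `w A₀`. -/
def floorTranspositions {n : ℕ} [NeZero n] (m : ℕ) (w : AffineSymm n) :
    Set (Equiv.Perm (Fin n)) :=
  {x | ∃ i j : Fin n, i < j ∧ IsFloor (root i j) m (w • A₀ n) ∧ x = Equiv.swap i j}

/-- `G^X`: the permutations `ρ` with `ℓ(ρ x) > ℓ(ρ)` for all `x ∈ X`. -/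
def ascentSet {n : ℕ} (X : Set (Equiv.Perm (Fin n))) : Set (Equiv.Perm (Fin n)) :=
  {ρ | ∀ x ∈ X, finLength (ρ * x) > finLength ρ}

end ShiArr

end

namespace ShiArr

/-! ### Word length -/

/-! Extend `v` to ℤ by `v_{x+n} = v_x - 1`. Then `v` lies in `w A₀` exactly when the extended
sequence decreases along `w 0, w 1, ...` (`mem_smul_A₀`), so an alcove amounts to an order in which
the integers are listed, and it is recorded by the numbers `shiCoord w i j`. The length of `w` is
the sum of their absolute values over `i < j` (`affLength_eq`), the region is given by the truth of
`k ≤ shiCoord w i j` for `-m < k ≤ m` (`isMinimalAlcove_iff`), and left multiplication by `ρ` only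
permutes the indices. For `k > 0`, `H_{ε_a-ε_b,k}` is a floor exactly when `b` comes immediately
after `a + k n` in the list (`adjacent_of_isFloor`, `isFloor_of_adjacent`). Crossing it changes only
the coordinate of the pair `a, b`, from `k` to `k - 1`.

Necessity (`le_of_adjacent`): crossing the image under `ρ` of such a floor shortens `ρ w`, so if `ρ
w A₀` is minimal this image must belong to the arrangement. It is `H_{α,k}` with `α` positive if `ρ
a < ρ b`, and `H_{α,-k}` otherwise; as the arrangement is asymmetric (`-m < k ≤ m`), this says `k ≤
m`, with `k = m` only if `ρ a < ρ b`. The last inequality is equivalent to `ℓ(ρ s) > ℓ(ρ)` for the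
transposition `s` of `a` and `b` (`finLength_lt_mul_swap_iff`).

Sufficiency (`isMinimalAlcove_finEmbed_mul`): if all floors obey these bounds, each coordinate of
`w` above its bound splits as a sum of bounds on two shorter roots (`exists_between`). By induction
on `j - i`, every alcove in the region has coordinates at least those of `w`, which are nonnegative
by dominance, and hence has at least the same length. -/

theorem wordLength_eq {Γ : Type*} [Group Γ] (S : Set Γ) (f : Γ → ℕ) (h_one : f 1 = 0)
    (h_up : ∀ g, ∀ s ∈ S, f (g * s) ≤ f g + 1)
    (h_down : ∀ g, g ≠ 1 → ∃ s ∈ S, s * s = 1 ∧ f (g * s) + 1 ≤ f g) (g : Γ) :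
    wordLength S g = f g := by
  -- Removing descents one at a time spells `g` with at most `f g` letters; conversely `hle` bounds
  -- `f` by the length of any word.
  have hex : ∀ k : ℕ, ∀ g, f g ≤ k →
      ∃ l : List Γ, l.length ≤ f g ∧ (∀ s ∈ l, s ∈ S) ∧ l.prod = g := by
    intro k
    induction k with
    | zero =>
      intro g hg
      by_cases h : g = 1
      · exact ⟨[], by simp, by simp, by simp [h]⟩
      · obtain ⟨s, -, -, h⟩ := h_down g h
        omega
    | succ k ih =>
      intro g hg
      by_cases h : g = 1
      · exact ⟨[], by simp, by simp, by simp [h]⟩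
      · obtain ⟨s, hs, hss, h⟩ := h_down g h
        obtain ⟨l, hl, hlS, hlp⟩ := ih (g * s) (by omega)
        refine ⟨l ++ [s], by simp; omega, ?_, ?_⟩
        · intro x hx
          rcases List.mem_append.1 hx with hx | hx
          · exact hlS x hx
          · rw [List.mem_singleton.1 hx]; exact hs
        · rw [List.prod_append, hlp, List.prod_singleton, mul_assoc, hss, mul_one]
  have hle : ∀ l : List Γ, (∀ s ∈ l, s ∈ S) → f l.prod ≤ l.length := by
    intro l
    induction l using List.reverseRecOn with
    | nil => simp [h_one]
    | append_singleton l s ih =>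
      intro h
      rw [List.prod_append, List.prod_singleton, List.length_append, List.length_singleton]
      have h1 := ih fun x hx => h x (by simp [hx])
      have h2 := h_up l.prod s (h s (by simp))
      omega
  obtain ⟨l, hl, hlS, hlp⟩ := hex _ g le_rfl
  have hmem : l.length ∈ {k : ℕ | ∃ l : List Γ, l.length = k ∧ (∀ s ∈ l, s ∈ S) ∧ l.prod = g} :=
    ⟨l, rfl, hlS, hlp⟩
  apply le_antisymm
  · exact (Nat.sInf_le hmem).trans hl
  · have hne := Set.nonempty_of_mem hmem
    obtain ⟨l', hl', hlS', hlp'⟩ := Nat.sInf_mem hne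
    have := hle l' hlS'
    rw [hlp', hl'] at this
    exact this

/-! ### Positions and residues -/

section

variable {n : ℕ} [NeZero n]

theorem exists_fin_add_mul (n : ℕ) [NeZero n] (x : ℤ) :
    ∃ (r : Fin n) (q : ℤ), x = (r : ℕ) + q * n := by
  obtain ⟨⟨q, r⟩, rfl⟩ := (Int.divModEquiv n).symm.surjective x
  exact ⟨r, q, by rw [Int.divModEquiv_symm_apply]; ring⟩

theorem fin_add_mul_inj {r s : Fin n} {p q : ℤ}
    (h : ((r : ℕ) : ℤ) + p * n = (s : ℕ) + q * n) : r = s ∧ p = q := by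
  have hd : ∀ (q : ℤ) (r : Fin n), Int.divModEquiv n ((r : ℕ) + q * n) = (q, r) := by
    intro q r
    rw [show ((r : ℕ) : ℤ) + q * n = (Int.divModEquiv n).symm (q, r) by
      rw [Int.divModEquiv_symm_apply]; ring, Equiv.apply_symm_apply]
  have := congrArg (Int.divModEquiv n) h
  rw [hd, hd, Prod.mk.injEq] at this
  exact ⟨this.2, this.1⟩

theorem apply_add_mul (w : AffineSymm n) (x q : ℤ) : w.1 (x + q * n) = w.1 x + q * n :=
  periodic_add_mul w.2.1 x q

theorem apply_inv_apply (w : AffineSymm n) (x : ℤ) : w.1 ((w⁻¹).1 x) = x :=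
  w.1.apply_symm_apply x

theorem inv_apply_apply (w : AffineSymm n) (x : ℤ) : (w⁻¹).1 (w.1 x) = x :=
  w.1.symm_apply_apply x

theorem affineSymm_ext {u w : AffineSymm n} (h : ∀ i : Fin n, u.1 (i : ℕ) = w.1 (i : ℕ)) :
    u = w := by
  apply Subtype.ext
  ext x
  obtain ⟨r, q, rfl⟩ := exists_fin_add_mul n x
  rw [apply_add_mul, apply_add_mul, h]

theorem finEmbed_apply (ρ : Equiv.Perm (Fin n)) (r : Fin n) (q : ℤ) :
    (finEmbed n ρ).1 ((r : ℕ) + q * n) = (ρ r : ℕ) + q * n := by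
  have h : Int.divModEquiv n ((r : ℕ) + q * n) = (q, r) := by
    rw [show ((r : ℕ) : ℤ) + q * n = (Int.divModEquiv n).symm (q, r) by
      rw [Int.divModEquiv_symm_apply]; ring, Equiv.apply_symm_apply]
  change (Int.divModEquiv n).symm (Prod.map id ρ (Int.divModEquiv n ((r : ℕ) + q * n))) = _
  rw [h, Prod.map_apply, Int.divModEquiv_symm_apply, id]
  ring

theorem finEmbed_apply_fin (ρ : Equiv.Perm (Fin n)) (r : Fin n) :
    (finEmbed n ρ).1 (r : ℕ) = (ρ r : ℕ) := by
  simpa using finEmbed_apply ρ r 0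

/-- The position of the alcove `w A₀` in the direction `ε_i - ε_j`: the integer `k` such that
`k ≤ v_i - v_j ≤ k + 1` on `w A₀`. -/
def shiCoord (w : AffineSymm n) (i j : Fin n) : ℤ :=
  ((w⁻¹).1 (j : ℕ) - (w⁻¹).1 (i : ℕ)) / n

theorem natCast_pos_int (n : ℕ) [NeZero n] : (0 : ℤ) < n := by
  exact_mod_cast Nat.pos_of_neZero n

/-- The form in which coordinates are used: since points of `w A₀` decrease along `w`, `v_i - v_j ≥
k` holds there exactly when `i + k n` is listed no later than `j`. -/
theorem le_shiCoord (w : AffineSymm n) (i j : Fin n) (k : ℤ) :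
    k ≤ shiCoord w i j ↔ (w⁻¹).1 (i : ℕ) + k * n ≤ (w⁻¹).1 (j : ℕ) := by
  rw [shiCoord, Int.le_ediv_iff_mul_le (natCast_pos_int n)]
  constructor <;> intro h <;> linarith

theorem pos_ne (w : AffineSymm n) {i j : Fin n} (h : i ≠ j) (k : ℤ) :
    (w⁻¹).1 (i : ℕ) + k * n ≠ (w⁻¹).1 (j : ℕ) := by
  intro e
  rw [← apply_add_mul] at e
  have e := (w⁻¹).1.injective e
  exact h (fin_add_mul_inj (q := 0) (by rw [e]; simp)).1

/-- The difference of two positions is never a multiple of `n`, so the floors of a non-integer and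
of its negative add up to `-1`. -/
theorem shiCoord_swap (w : AffineSymm n) {i j : Fin n} (h : i ≠ j) :
    shiCoord w j i = -1 - shiCoord w i j := by
  refine eq_of_forall_le_iff fun k => ?_
  have h1 := le_shiCoord w i j (-k)
  have h2 := pos_ne w h (-k)
  rw [le_shiCoord]
  rw [show k ≤ -1 - shiCoord w i j ↔ ¬ (-k ≤ shiCoord w i j) by constructor <;> intro <;> omega, h1]
  rw [neg_mul] at *
  constructor
  · intro a b
    exact h2 (by linarith)
  · intro a
    linarith

theorem shiCoord_finEmbed_mul (ρ : Equiv.Perm (Fin n)) (w : AffineSymm n) (i j : Fin n) :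
    shiCoord (finEmbed n ρ * w) i j = shiCoord w (ρ⁻¹ i) (ρ⁻¹ j) := by
  have h : ∀ i : Fin n, ((finEmbed n ρ * w)⁻¹).1 (i : ℕ) = (w⁻¹).1 ((ρ⁻¹ i : Fin n) : ℕ) := by
    intro i
    rw [mul_inv_rev, ← map_inv]
    change (w⁻¹).1 ((finEmbed n ρ⁻¹).1 (i : ℕ)) = _
    rw [finEmbed_apply_fin]
  rw [shiCoord, shiCoord, h, h]

/-! ### Adjacent transpositions -/

theorem not_dvd_one {n : ℕ} (hn : 2 ≤ n) : ¬ (n : ℤ) ∣ 1 := by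
  intro h
  have := Int.le_of_dvd one_pos h
  omega

theorem adjFun_involutive {n : ℕ} (hn : 2 ≤ n) (t : ℤ) : Function.Involutive fun x : ℤ =>
    if (n : ℤ) ∣ x - t then x + 1 else if (n : ℤ) ∣ x - (t + 1) then x - 1 else x := by
  intro x
  have h1 := not_dvd_one hn
  by_cases a : (n : ℤ) ∣ x - t
  · have b : ¬ (n : ℤ) ∣ x + 1 - t := fun b => h1 (by
      have := dvd_sub b a
      rwa [show x + 1 - t - (x - t) = 1 by ring] at this)
    have c : (n : ℤ) ∣ x + 1 - (t + 1) := by rwa [show x + 1 - (t + 1) = x - t by ring]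
    simp [a, b]
  · by_cases b : (n : ℤ) ∣ x - (t + 1)
    · have c : (n : ℤ) ∣ x - 1 - t := by rwa [show x - 1 - t = x - (t + 1) by ring]
      simp [a, b, c]
    · simp [a, b]

/-- The permutation of `ℤ` interchanging `t + q n` and `t + 1 + q n` for all `q`. -/
def adjPerm {n : ℕ} (hn : 2 ≤ n) (t : ℤ) : Equiv.Perm ℤ :=
  (adjFun_involutive hn t).toPerm

theorem adjPerm_apply {n : ℕ} (hn : 2 ≤ n) (t x : ℤ) : adjPerm hn t x =
    if (n : ℤ) ∣ x - t then x + 1 else if (n : ℤ) ∣ x - (t + 1) then x - 1 else x := rfl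

theorem adjPerm_periodic {n : ℕ} (hn : 2 ≤ n) (t : ℤ) : IsPeriodicPerm n (adjPerm hn t) := by
  intro x
  have h : ∀ s : ℤ, (n : ℤ) ∣ x + n - s ↔ (n : ℤ) ∣ x - s := fun s => by
    rw [show x + n - s = x - s + n by ring, dvd_add_self_right]
  simp only [adjPerm_apply, h]
  split_ifs <;> ring

/-- The simple reflection of `S̃ₙ` interchanging `t` and `t + 1`. -/
def adjSwap (hn : 2 ≤ n) (t : ℤ) : AffineSymm n :=
  ⟨adjPerm hn t, adjPerm_periodic hn t, by
    have hp : IsPeriodicPerm n (Equiv.addRight (1 : ℤ)) := fun x => by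
      simp only [Equiv.coe_addRight]; ring
    -- The displacement of `i` is the indicator of `i + 1 ≡ t + 1` minus that of `i ≡ t + 1`; summed
    -- over a window these agree by invariance under the shift by one.
    have h := sum_window hp (fun x => if (n : ℤ) ∣ x - (t + 1) then (1 : ℤ) else 0) (fun x q => by
      have : (n : ℤ) ∣ x + q * n - (t + 1) ↔ (n : ℤ) ∣ x - (t + 1) := by
        rw [show x + q * n - (t + 1) = x - (t + 1) + q * n by ring]
        exact Int.dvd_add_left (Dvd.intro_left q rfl)
      simp only [this])
    have e : ∀ i : Fin n, adjPerm hn t (i : ℕ) = ((i : ℕ) : ℤ) +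
        ((if (n : ℤ) ∣ (Equiv.addRight (1 : ℤ)) (i : ℕ) - (t + 1) then (1 : ℤ) else 0) -
        if (n : ℤ) ∣ ((i : ℕ) : ℤ) - (t + 1) then (1 : ℤ) else 0) := by
      intro i
      rw [adjPerm_apply, Equiv.coe_addRight,
        show ((i : ℕ) : ℤ) + 1 - (t + 1) = ((i : ℕ) : ℤ) - t by ring]
      by_cases a : (n : ℤ) ∣ ((i : ℕ) : ℤ) - t
      · have b : ¬ (n : ℤ) ∣ ((i : ℕ) : ℤ) - (t + 1) := fun b => not_dvd_one hn (by
          have := dvd_sub a b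
          rwa [show ((i : ℕ) : ℤ) - t - (((i : ℕ) : ℤ) - (t + 1)) = 1 by ring] at this)
        rw [if_pos a, if_pos a, if_neg b]; ring
      · rw [if_neg a, if_neg a]
        split_ifs <;> ring
    rw [Finset.sum_congr rfl fun i _ => e i, Finset.sum_add_distrib, Finset.sum_sub_distrib, h]
    ring⟩

theorem adjSwap_apply_left (hn : 2 ≤ n) (t q : ℤ) :
    (adjSwap hn t).1 (t + q * n) = t + 1 + q * n := by
  change adjPerm hn t _ = _
  rw [adjPerm_apply, if_pos (by rw [add_sub_cancel_left]; exact Dvd.intro_left q rfl)]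
  ring

theorem adjSwap_apply_right (hn : 2 ≤ n) (t q : ℤ) :
    (adjSwap hn t).1 (t + 1 + q * n) = t + q * n := by
  change adjPerm hn t _ = _
  have h : (n : ℤ) ∣ t + 1 + q * n - (t + 1) := by
    rw [add_sub_cancel_left]; exact Dvd.intro_left q rfl
  rw [adjPerm_apply, if_neg, if_pos h]
  · ring
  · intro a
    have := dvd_sub a h
    rw [show t + 1 + q * n - t - (t + 1 + q * n - (t + 1)) = 1 by ring] at this
    exact not_dvd_one hn this

theorem adjSwap_apply_of_ne (hn : 2 ≤ n) {t x : ℤ} (h1 : ∀ q : ℤ, x ≠ t + q * n)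
    (h2 : ∀ q : ℤ, x ≠ t + 1 + q * n) : (adjSwap hn t).1 x = x := by
  change adjPerm hn t _ = _
  rw [adjPerm_apply, if_neg, if_neg]
  · rintro ⟨q, hq⟩
    exact h2 q (by linarith)
  · rintro ⟨q, hq⟩
    exact h1 q (by linarith)

theorem adjSwap_mul_self (hn : 2 ≤ n) (t : ℤ) : adjSwap hn t * adjSwap hn t = 1 := by
  apply Subtype.ext
  ext x
  exact adjFun_involutive hn t x

theorem adjSwap_inv (hn : 2 ≤ n) (t : ℤ) : (adjSwap hn t)⁻¹ = adjSwap hn t :=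
  inv_eq_of_mul_eq_one_right (adjSwap_mul_self hn t)

theorem adjSwap_add_mul (hn : 2 ≤ n) (t q : ℤ) : adjSwap hn (t + q * n) = adjSwap hn t := by
  have h : ∀ x s : ℤ, (n : ℤ) ∣ x - (s + q * n) ↔ (n : ℤ) ∣ x - s := fun x s => by
    rw [show x - (s + q * n) = x - s + -q * n by ring]
    exact Int.dvd_add_left (Dvd.intro_left (-q) rfl)
  apply Subtype.ext
  ext x
  change adjPerm hn _ x = adjPerm hn _ x
  simp only [adjPerm_apply, h, show t + q * n + 1 = t + 1 + q * n by ring]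

theorem finEmbed_swap (hn : 2 ≤ n) {i j : Fin n} (hij : (j : ℕ) = i + 1) :
    finEmbed n (Equiv.swap i j) = adjSwap hn (i : ℕ) := by
  apply affineSymm_ext
  intro k
  rw [finEmbed_apply_fin]
  by_cases h1 : k = i
  · subst h1
    have := adjSwap_apply_left hn (k : ℕ) 0
    rw [zero_mul, add_zero] at this
    rw [this, Equiv.swap_apply_left, hij]
    push_cast; ring
  by_cases h2 : k = j
  · subst h2
    have := adjSwap_apply_right hn (i : ℕ) 0
    rw [zero_mul, add_zero] at this
    rw [hij, Equiv.swap_apply_right]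
    push_cast
    rw [this]; ring
  · rw [Equiv.swap_apply_of_ne_of_ne h1 h2, adjSwap_apply_of_ne]
    · intro q e
      exact h1 (fin_add_mul_inj (p := 0) (q := q) (by rw [e]; ring)).1
    · intro q e
      exact h2 (fin_add_mul_inj (p := 0) (q := q) (by rw [e, hij]; push_cast; ring)).1

theorem adjSwap_neg_one_apply (hn : 2 ≤ n) : (adjSwap hn (-1)).1 0 = -1 ∧
    (adjSwap hn (-1)).1 (n - 1) = n ∧
      ∀ x : ℤ, 0 < x → x < n - 1 → (adjSwap hn (-1)).1 x = x := by
  refine ⟨?_, ?_, ?_⟩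
  · simpa using adjSwap_apply_right hn (-1) 0
  · have := adjSwap_apply_left hn (-1) 1
    rw [show (-1 : ℤ) + 1 * n = n - 1 by ring] at this
    rw [this]; ring
  · intro x h0 h1
    apply adjSwap_apply_of_ne
    · intro q e
      have := fin_add_mul_inj (n := n) (r := ⟨x.toNat, by omega⟩) (s := ⟨n - 1, by omega⟩)
        (p := 0) (q := q - 1) (by
          push_cast [show 1 ≤ n by omega, Int.toNat_of_nonneg h0.le]; rw [e]; ring)
      have := congrArg Fin.val this.1
      simp only at this
      omega
    · intro q e
      have := fin_add_mul_inj (n := n) (r := ⟨x.toNat, by omega⟩) (s := ⟨0, by omega⟩)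
        (p := 0) (q := q) (by
          push_cast [show 1 ≤ n by omega, Int.toNat_of_nonneg h0.le]; rw [e]; ring)
      have := congrArg Fin.val this.1
      simp only at this
      omega

theorem adjSwap_mem_affSimple (hn : 2 ≤ n) (t : ℤ) : adjSwap hn t ∈ affSimple n := by
  obtain ⟨r, q, rfl⟩ := exists_fin_add_mul n t
  rw [adjSwap_add_mul]
  by_cases h : (r : ℕ) + 1 < n
  · exact Or.inl ⟨Equiv.swap r ⟨r + 1, h⟩, ⟨r, _, rfl, rfl⟩, (finEmbed_swap hn rfl).symm⟩
  · right
    -- Only the residue `n - 1` is left, whose swap crosses the window boundary: this is `s₀`.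
    have e : (((r : ℕ) : ℤ)) = -1 + 1 * n := by omega
    rw [e, adjSwap_add_mul]
    exact adjSwap_neg_one_apply hn

theorem eq_adjSwap_of_mem_affSimple (hn : 2 ≤ n) {s : AffineSymm n} (hs : s ∈ affSimple n) :
    ∃ t, s = adjSwap hn t := by
  rcases hs with ⟨_, ⟨i, j, hij, rfl⟩, rfl⟩ | ⟨h1, h2, h3⟩
  · exact ⟨_, finEmbed_swap hn hij⟩
  · refine ⟨-1, affineSymm_ext fun i => ?_⟩
    obtain ⟨g1, g2, g3⟩ := adjSwap_neg_one_apply hn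
    by_cases a : (i : ℕ) = 0
    · rw [a, Nat.cast_zero, h1, g1]
    by_cases b : (i : ℕ) = n - 1
    · rw [b, show ((n - 1 : ℕ) : ℤ) = n - 1 by omega, h2, g2]
    · rw [h3 _ (by omega) (by omega), g3 _ (by omega) (by omega)]

/-! ### Lengths as sums of absolute values of positions -/

/-- The number of hyperplanes separating `w A₀` from `A₀`. -/
def sepCount (w : AffineSymm n) : ℕ :=
  ∑ e : Fin n × Fin n with e.1 < e.2, (shiCoord w e.1 e.2).natAbs

/-- `w` sends some `t` to `a + p n` and `t + 1` to `b + q n`; the position of `w (t t+1)` differs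
from that of `w` in the directions `±(ε_a - ε_b)` only. -/
theorem shiCoord_mul_adjSwap (hn : 2 ≤ n) (w : AffineSymm n) {a b : Fin n} {k : ℤ}
    (h : (w⁻¹).1 (b : ℕ) = (w⁻¹).1 (a : ℕ) + k * n + 1) :
    a ≠ b ∧ shiCoord w a b = k ∧
    shiCoord (w * adjSwap hn ((w⁻¹).1 (a : ℕ))) a b = k - 1 ∧
    ∀ i j, i ≠ j → (i, j) ≠ (a, b) → (i, j) ≠ (b, a) →
      shiCoord (w * adjSwap hn ((w⁻¹).1 (a : ℕ))) i j = shiCoord w i j := by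
  have hnpos := natCast_pos_int n
  have hab : a ≠ b := by
    rintro rfl
    exact not_dvd_one hn ⟨-k, by linarith⟩
  set t := (w⁻¹).1 (a : ℕ) with ht
  have hinv : ∀ x, ((w * adjSwap hn t)⁻¹).1 x = (adjSwap hn t).1 ((w⁻¹).1 x) := by
    intro x
    rw [mul_inv_rev, adjSwap_inv]
    rfl
  have ha : ((w * adjSwap hn t)⁻¹).1 (a : ℕ) = t + 1 := by
    rw [hinv, ← ht]
    simpa using adjSwap_apply_left hn t 0
  have hb : ((w * adjSwap hn t)⁻¹).1 (b : ℕ) = t + k * n := by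
    rw [hinv, h, show t + k * n + 1 = t + 1 + k * n by ring, adjSwap_apply_right]
  have ho : ∀ i, i ≠ a → i ≠ b → ((w * adjSwap hn t)⁻¹).1 (i : ℕ) = (w⁻¹).1 (i : ℕ) := by
    intro i h1 h2
    rw [hinv]
    apply adjSwap_apply_of_ne
    · intro q e
      exact pos_ne w h1.symm q e.symm
    · intro q e
      exact pos_ne w h2.symm (q - k) (by rw [e, h]; ring)
  refine ⟨hab, ?_, ?_, ?_⟩
  · refine eq_of_forall_le_iff fun l => ?_
    rw [le_shiCoord, h, ← ht]
    constructor
    · intro h1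
      by_contra h2
      have : (k + 1) * n ≤ l * n := mul_le_mul_of_nonneg_right (by omega) hnpos.le
      have h3 : (2 : ℤ) ≤ n := by exact_mod_cast hn
      linarith
    · intro h1
      have : l * n ≤ k * n := mul_le_mul_of_nonneg_right (by omega) hnpos.le
      linarith
  · refine eq_of_forall_le_iff fun l => ?_
    rw [le_shiCoord, ha, hb]
    constructor
    · intro h1
      by_contra h2
      have : k * n ≤ l * n := mul_le_mul_of_nonneg_right (by omega) hnpos.le
      linarith
    · intro h1
      have : l * n ≤ (k - 1) * n := mul_le_mul_of_nonneg_right (by omega) hnpos.le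
      have h3 : (2 : ℤ) ≤ n := by exact_mod_cast hn
      linarith
  -- A position moves by at most one step, so a comparison could change only if the other position
  -- met a translate of one of the swapped places; `pos_ne` excludes this.
  · intro i j hij h1 h2
    refine eq_of_forall_le_iff fun l => ?_
    have hne := pos_ne w hij l
    rw [le_shiCoord, le_shiCoord]
    have hva : (w⁻¹).1 (a : ℕ) = t := ht.symm
    by_cases hia : i = a
    · subst hia
      have hj : j ≠ b := fun e => h1 (by rw [e])
      rw [ha, ho j hij.symm hj]
      constructor <;> intro <;> omega
    by_cases hib : i = b
    · subst hib
      have hj : j ≠ a := fun e => h2 (by rw [e])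
      rw [hb, ho j hj hij.symm, h]
      have := pos_ne w hj.symm (k + l)
      rw [hva, add_mul] at this
      constructor <;> intro <;> omega
    rw [ho i hia hib]
    by_cases hja : j = a
    · subst hja
      have := pos_ne w hib (l + k)
      rw [h, add_mul] at this
      rw [ha, hva]
      constructor <;> intro <;> omega
    by_cases hjb : j = b
    · subst hjb
      have := pos_ne w hia (l - k)
      rw [hb, h]
      rw [hva, sub_mul] at this
      constructor <;> intro <;> omega
    rw [ho j hja hjb]

theorem sum_add_eq_of_eq_off {ι : Type*} [DecidableEq ι] {s : Finset ι} {f g : ι → ℕ} {e : ι}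
    (he : e ∈ s) (h : ∀ x ∈ s, x ≠ e → f x = g x) : ∑ x ∈ s, f x + g e = ∑ x ∈ s, g x + f e := by
  rw [← Finset.add_sum_erase s f he, ← Finset.add_sum_erase s g he,
    Finset.sum_congr rfl fun x hx => h x (Finset.mem_of_mem_erase hx) (Finset.ne_of_mem_erase hx)]
  ring

/-- If `w⁻¹ b = w⁻¹ a + k n + 1`, then the number of separating hyperplanes changes by one when
`w` is multiplied by the adjacent transposition at `w⁻¹ a`; the sign is that of `a + k n - b`. -/
theorem sepCount_mul_adjSwap (hn : 2 ≤ n) (w : AffineSymm n) {a b : Fin n} {k : ℤ}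
    (h : (w⁻¹).1 (b : ℕ) = (w⁻¹).1 (a : ℕ) + k * n + 1) :
    sepCount (w * adjSwap hn ((w⁻¹).1 (a : ℕ))) ≤ sepCount w + 1 ∧
    (((b : ℕ) : ℤ) < (a : ℕ) + k * n →
      sepCount (w * adjSwap hn ((w⁻¹).1 (a : ℕ))) + 1 ≤ sepCount w) := by
  obtain ⟨hab, h1, h2, h3⟩ := shiCoord_mul_adjSwap hn w h
  have hnpos := natCast_pos_int n
  set w' := w * adjSwap hn ((w⁻¹).1 (a : ℕ))
  have h1' := shiCoord_swap w hab
  have h2' := shiCoord_swap w' hab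
  rw [h1] at h1'
  rw [h2] at h2'
  unfold sepCount
  -- `sepCount` sees only pairs in increasing order: the entry goes from `k` to `k - 1` if `a < b`,
  -- and from `-1 - k` to `-k` if `b < a`. The condition `b < a + k n` forces `k > 0`, respectively
  -- `k ≥ 0`, so that the absolute value drops.
  rcases lt_or_gt_of_ne hab with hlt | hlt
  · have key := sum_add_eq_of_eq_off (s := {e : Fin n × Fin n | e.1 < e.2}) (e := (a, b))
      (f := fun e => (shiCoord w' e.1 e.2).natAbs) (g := fun e => (shiCoord w e.1 e.2).natAbs)
      (by simpa using hlt) (by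
        rintro ⟨i, j⟩ hij hne
        simp only [Finset.mem_filter, Finset.mem_univ, true_and] at hij
        simp only
        rw [h3 i j hij.ne hne]
        rintro e
        rw [Prod.mk.injEq] at e
        rw [e.1, e.2] at hij
        exact absurd hij hlt.asymm)
    simp only [h1, h2] at key
    refine ⟨by omega, fun hk => ?_⟩
    have : 0 < k := by
      by_contra hk'
      have h5 : k * n ≤ 0 := mul_nonpos_of_nonpos_of_nonneg (by omega) hnpos.le
      have h6 : ((a : ℕ) : ℤ) < (b : ℕ) := by exact_mod_cast hlt
      omega
    omega
  · have key := sum_add_eq_of_eq_off (s := {e : Fin n × Fin n | e.1 < e.2}) (e := (b, a))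
      (f := fun e => (shiCoord w' e.1 e.2).natAbs) (g := fun e => (shiCoord w e.1 e.2).natAbs)
      (by simpa using hlt) (by
        rintro ⟨i, j⟩ hij hne
        simp only [Finset.mem_filter, Finset.mem_univ, true_and] at hij
        simp only
        rw [h3 i j hij.ne _ hne]
        rintro e
        rw [Prod.mk.injEq] at e
        rw [e.1, e.2] at hij
        exact absurd hij hlt.asymm)
    simp only [h1', h2'] at key
    refine ⟨by omega, fun hk => ?_⟩
    have : 0 ≤ k := by
      by_contra hk'
      have h5 : k * n ≤ -1 * n := mul_le_mul_of_nonneg_right (by omega) hnpos.le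
      have h6 := a.2
      omega
    omega

/-- Every pair of adjacent positions has the form required by `sepCount_mul_adjSwap`. -/
theorem exists_adjacent (w : AffineSymm n) (t : ℤ) : ∃ (a b : Fin n) (p q : ℤ),
    w.1 t = (a : ℕ) + p * n ∧ w.1 (t + 1) = (b : ℕ) + q * n ∧
    (w⁻¹).1 (a : ℕ) = t + -p * n ∧ (w⁻¹).1 (b : ℕ) = (w⁻¹).1 (a : ℕ) + (p - q) * n + 1 := by
  obtain ⟨a, p, ha⟩ := exists_fin_add_mul n (w.1 t)
  obtain ⟨b, q, hb⟩ := exists_fin_add_mul n (w.1 (t + 1))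
  have ha' : (w⁻¹).1 (a : ℕ) = t + -p * n := by
    rw [show ((a : ℕ) : ℤ) = w.1 t + -p * n by rw [ha]; ring, apply_add_mul, inv_apply_apply]
  refine ⟨a, b, p, q, ha, hb, ha', ?_⟩
  rw [show ((b : ℕ) : ℤ) = w.1 (t + 1) + -q * n by rw [hb]; ring, apply_add_mul, inv_apply_apply,
    ha']
  ring

theorem sepCount_mul_adjSwap_le (hn : 2 ≤ n) (w : AffineSymm n) (t : ℤ) :
    sepCount (w * adjSwap hn t) ≤ sepCount w + 1 := by
  obtain ⟨a, b, p, q, -, -, ha, h⟩ := exists_adjacent w t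
  have := (sepCount_mul_adjSwap hn w h).1
  rwa [ha, adjSwap_add_mul] at this

theorem sepCount_mul_adjSwap_lt (hn : 2 ≤ n) (w : AffineSymm n) {t : ℤ}
    (hlt : w.1 (t + 1) < w.1 t) : sepCount (w * adjSwap hn t) + 1 ≤ sepCount w := by
  obtain ⟨a, b, p, q, ha', hb', ha, h⟩ := exists_adjacent w t
  have := (sepCount_mul_adjSwap hn w h).2 (by rw [ha', hb'] at hlt; linarith)
  rwa [ha, adjSwap_add_mul] at this

/-- An increasing bijection of ℤ is a translation, and the normalised window sum makes the
translation trivial. -/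
theorem eq_one_of_forall_lt (w : AffineSymm n) (h : ∀ t, w.1 t < w.1 (t + 1)) : w = 1 := by
  have hm : StrictMono w.1 := strictMono_int_of_lt_succ h
  have hstep : ∀ t, w.1 (t + 1) = w.1 t + 1 := by
    intro t
    obtain ⟨y, hy⟩ := w.1.surjective (w.1 t + 1)
    have h1 : t < y := hm.lt_iff_lt.1 (by omega)
    have h2 := hm.monotone (show t + 1 ≤ y by omega)
    have := h t
    omega
  have hx : ∀ k : ℕ, w.1 (k : ℤ) = k + w.1 0 := by
    intro k
    induction k with
    | zero => simp
    | succ k ih => push_cast; rw [hstep, ih]; ring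
  have hs := w.2.2
  simp only [hx, Finset.sum_add_distrib, Finset.sum_const, Finset.card_univ, Fintype.card_fin] at hs
  have h0 : w.1 0 = 0 := by
    have : n • w.1 0 = 0 := by linarith
    rw [nsmul_eq_mul] at this
    exact (mul_eq_zero.1 this).resolve_left (natCast_pos_int n).ne'
  apply affineSymm_ext
  intro i
  rw [hx, h0, add_zero]
  rfl

theorem exists_descent {w : AffineSymm n} (h : w ≠ 1) : ∃ t, w.1 (t + 1) < w.1 t := by
  by_contra! hc
  refine h (eq_one_of_forall_lt w fun t => lt_of_le_of_ne (hc t) fun e => ?_)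
  have := w.1.injective e
  omega

theorem sepCount_one : sepCount (1 : AffineSymm n) = 0 := by
  rw [sepCount]
  refine Finset.sum_eq_zero ?_
  rintro ⟨i, j⟩ hij
  simp only [Finset.mem_filter, Finset.mem_univ, true_and] at hij
  have h : ((i : ℕ) : ℤ) < (j : ℕ) := by exact_mod_cast hij
  rw [Int.natAbs_eq_zero, shiCoord, inv_one]
  change (((j : ℕ) : ℤ) - (i : ℕ)) / n = 0
  exact Int.ediv_eq_zero_of_lt (by omega) (by omega)

theorem affLength_eq (hn : 2 ≤ n) (w : AffineSymm n) : affLength w = sepCount w := by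
  refine wordLength_eq _ _ sepCount_one ?_ ?_ w
  · intro g s hs
    obtain ⟨t, rfl⟩ := eq_adjSwap_of_mem_affSimple hn hs
    exact sepCount_mul_adjSwap_le hn g t
  · intro g hg
    obtain ⟨t, ht⟩ := exists_descent hg
    exact ⟨_, adjSwap_mem_affSimple hn t, adjSwap_mul_self hn t, sepCount_mul_adjSwap_lt hn g ht⟩

/-! ### Length and inversions in the finite symmetric group. -/

theorem finEmbed_injective : Function.Injective (finEmbed n) := by
  intro ρ τ h
  ext i
  have := finEmbed_apply_fin ρ i
  rw [h, finEmbed_apply_fin] at this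
  exact_mod_cast this.symm

theorem finLength_eq (hn : 2 ≤ n) (ρ : Equiv.Perm (Fin n)) :
    finLength ρ = sepCount (finEmbed n ρ) := by
  refine wordLength_eq _ (fun ρ => sepCount (finEmbed n ρ)) (by simp [sepCount_one]) ?_ ?_ ρ
  · rintro g _ ⟨i, j, hij, rfl⟩
    rw [map_mul, finEmbed_swap hn hij]
    exact sepCount_mul_adjSwap_le hn _ _
  · intro g hg
    obtain ⟨t, ht⟩ := exists_descent (w := finEmbed n g) fun h =>
      hg (finEmbed_injective (h.trans (map_one _).symm))
    obtain ⟨r, q, rfl⟩ := exists_fin_add_mul n t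
    -- An element of `Sₙ` preserves each block of `n` integers, so no descent straddles two blocks,
    -- and `s₀` is not needed.
    have hr : (r : ℕ) + 1 < n := by
      by_contra hr
      rw [show ((r : ℕ) : ℤ) + q * n + 1 = ((0 : Fin n) : ℕ) + (q + 1) * n by
        have := r.2
        rw [add_mul, Fin.val_zero]; omega, finEmbed_apply, finEmbed_apply, add_mul] at ht
      have := (g r).2
      omega
    refine ⟨Equiv.swap r ⟨r + 1, hr⟩, ⟨r, _, rfl, rfl⟩, Equiv.swap_mul_self _ _, ?_⟩
    rw [map_mul, finEmbed_swap hn rfl]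
    have := sepCount_mul_adjSwap_lt hn _ ht
    rwa [adjSwap_add_mul] at this

/-- The inversions of a permutation. -/
def inversions {n : ℕ} (τ : Equiv.Perm (Fin n)) : Finset (Fin n × Fin n) :=
  {e | e.1 < e.2 ∧ τ e.2 < τ e.1}

theorem mem_inversions {n : ℕ} {τ : Equiv.Perm (Fin n)} {i j : Fin n} :
    (i, j) ∈ inversions τ ↔ i < j ∧ τ j < τ i := by
  simp [inversions]

theorem sepCount_finEmbed (ρ : Equiv.Perm (Fin n)) :
    sepCount (finEmbed n ρ) = (inversions ρ⁻¹).card := by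
  rw [sepCount, inversions, ← Finset.filter_filter, Finset.card_filter]
  refine Finset.sum_congr rfl ?_
  rintro ⟨i, j⟩ hij
  simp only [Finset.mem_filter, Finset.mem_univ, true_and] at hij
  have hne : ρ⁻¹ i ≠ ρ⁻¹ j := fun e => hij.ne (ρ⁻¹.injective e)
  have hK : shiCoord (finEmbed n ρ) i j = (((ρ⁻¹ j : Fin n) : ℕ) - ((ρ⁻¹ i : Fin n) : ℕ) : ℤ) / n := by
    rw [shiCoord, ← map_inv, finEmbed_apply_fin, finEmbed_apply_fin]
  have hnpos := natCast_pos_int n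
  have hi := (ρ⁻¹ i).2
  have hj := (ρ⁻¹ j).2
  simp only [hK]
  split_ifs with h
  · have h' : ((ρ⁻¹ j : Fin n) : ℕ) < ((ρ⁻¹ i : Fin n) : ℕ) := h
    have : (((ρ⁻¹ j : Fin n) : ℕ) - ((ρ⁻¹ i : Fin n) : ℕ) : ℤ) / n = -1 := by
      rw [Int.ediv_eq_iff_of_pos hnpos]
      omega
    rw [this]; rfl
  · have h' : ((ρ⁻¹ i : Fin n) : ℕ) ≤ ((ρ⁻¹ j : Fin n) : ℕ) := not_lt.1 h
    rw [Int.ediv_eq_zero_of_lt (by omega) (by omega)]; rfl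

/-- Apply the transposition to both entries of an inversion of `τ` when this keeps them in order,
and leave the pair alone otherwise. This is an injection into the inversions of the product, and it
misses `(a, b)`. -/
theorem card_inversions_lt {n : ℕ} (τ : Equiv.Perm (Fin n)) {a b : Fin n} (hab : a < b)
    (h : τ a < τ b) : (inversions τ).card < (inversions (τ * Equiv.swap a b)).card := by
  set x := Equiv.swap a b with hx
  have hxx : ∀ i, x (x i) = i := fun i => Equiv.swap_apply_self a b i
  have hmem : ((a, b) : Fin n × Fin n) ∈ inversions (τ * x) := by
    simp [inversions, hab, hx, h]
  refine lt_of_le_of_lt (b := ((inversions (τ * x)).erase (a, b)).card) ?_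
    (Finset.card_erase_lt_of_mem hmem)
  refine Finset.card_le_card_of_injOn
    (fun e => if x e.1 < x e.2 then (x e.1, x e.2) else e) ?_ ?_
  · rintro ⟨i, j⟩ hij
    obtain ⟨h1, h2⟩ := mem_inversions.1 (Finset.mem_coe.1 hij)
    rw [Finset.mem_coe, Finset.mem_erase, and_comm]
    simp only
    split_ifs with hlt
    · rw [mem_inversions, Equiv.Perm.mul_apply, Equiv.Perm.mul_apply]
      refine ⟨⟨hlt, by rwa [hxx, hxx]⟩, fun e => ?_⟩
      rw [Prod.mk.injEq] at e
      have e1 : i = b := by rw [← hxx i, e.1, hx, Equiv.swap_apply_left]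
      have e2 : j = a := by rw [← hxx j, e.2, hx, Equiv.swap_apply_right]
      rw [e1, e2] at h1
      exact h1.asymm hab
    · rw [mem_inversions, Equiv.Perm.mul_apply, Equiv.Perm.mul_apply]
      refine ⟨⟨h1, ?_⟩, fun e => ?_⟩
      · by_cases hia : i = a
        · subst hia
          by_cases hjb : j = b
          · subst hjb
            exact absurd h h2.asymm
          · rw [hx, Equiv.swap_apply_left, Equiv.swap_apply_of_ne_of_ne h1.ne' hjb]
            exact h2.trans h
        by_cases hib : i = b
        · subst hib
          rw [hx, Equiv.swap_apply_right, Equiv.swap_apply_of_ne_of_ne (hab.trans h1).ne' h1.ne']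
            at hlt
          exact absurd (hab.trans h1) hlt
        by_cases hja : j = a
        · subst hja
          rw [hx, Equiv.swap_apply_left, Equiv.swap_apply_of_ne_of_ne hia hib] at hlt
          exact absurd (h1.trans hab) hlt
        by_cases hjb : j = b
        · subst hjb
          rw [hx, Equiv.swap_apply_right, Equiv.swap_apply_of_ne_of_ne hia hib]
          exact h.trans h2
        · rw [hx, Equiv.swap_apply_of_ne_of_ne hia hib, Equiv.swap_apply_of_ne_of_ne hja hjb]
          exact h2
      · rw [Prod.mk.injEq] at e
        rw [e.1, e.2] at h2
        exact h.asymm h2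
  · rintro ⟨i, j⟩ hij ⟨i', j'⟩ hij' e
    have hij := mem_inversions.1 (Finset.mem_coe.1 hij)
    have hij' := mem_inversions.1 (Finset.mem_coe.1 hij')
    simp only at e
    split_ifs at e with h1 h2 h2
    · rw [Prod.mk.injEq] at e ⊢
      exact ⟨x.injective e.1, x.injective e.2⟩
    · rw [Prod.mk.injEq] at e
      rw [← e.1, ← e.2, hxx, hxx] at h2
      exact absurd hij.1 h2
    · rw [Prod.mk.injEq] at e
      rw [e.1, e.2, hxx, hxx] at h1
      exact absurd hij'.1 h1
    · exact e

theorem finLength_lt_mul_swap (hn : 2 ≤ n) (ρ : Equiv.Perm (Fin n)) {a b : Fin n} (hab : a < b)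
    (h : ρ a < ρ b) : finLength ρ < finLength (ρ * Equiv.swap a b) := by
  rw [finLength_eq hn, finLength_eq hn, sepCount_finEmbed, sepCount_finEmbed, mul_inv_rev,
    Equiv.swap_inv]
  -- The length counts inversions of the inverse, so the transposition arrives on the left;
  -- conjugation moves it to the right.
  have e : Equiv.swap a b * ρ⁻¹ = ρ⁻¹ * Equiv.swap (ρ a) (ρ b) := by
    ext i
    simp only [Equiv.Perm.mul_apply]
    by_cases h1 : i = ρ a
    · simp [h1]
    by_cases h2 : i = ρ b
    · simp [h2]
    · rw [Equiv.swap_apply_of_ne_of_ne h1 h2, Equiv.swap_apply_of_ne_of_ne]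
      · intro e; exact h1 (by simp [← e])
      · intro e; exact h2 (by simp [← e])
  rw [e]
  exact card_inversions_lt _ h (by simpa using hab)

theorem finLength_lt_mul_swap_iff (hn : 2 ≤ n) (ρ : Equiv.Perm (Fin n)) {a b : Fin n}
    (hab : a < b) : finLength ρ < finLength (ρ * Equiv.swap a b) ↔ ρ a < ρ b := by
  refine ⟨fun h => ?_, finLength_lt_mul_swap hn ρ hab⟩
  by_contra hc
  have hlt : ρ b < ρ a := lt_of_le_of_ne (not_lt.1 hc) fun e => hab.ne' (ρ.injective e)
  have := finLength_lt_mul_swap hn (ρ * Equiv.swap a b) hab (by simpa using hlt)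
  rw [mul_assoc, Equiv.swap_mul_self, mul_one] at this
  exact h.asymm this

/-! ### Alcoves in coordinates -/

theorem inner_root {n : ℕ} (v : V n) (i j : Fin n) : inner ℝ v (root i j) = v.1 i - v.1 j := by
  change inner ℝ v.1 (EuclideanSpace.single i 1 - EuclideanSpace.single j 1) = _
  rw [inner_sub_right, EuclideanSpace.inner_single_right, EuclideanSpace.inner_single_right]
  simp

theorem mem_hyperplane {n : ℕ} {v : V n} {i j : Fin n} {k : ℤ} :
    v ∈ hyperplane (root i j) k ↔ v.1 i - v.1 j = k := by
  rw [← inner_root]; rfl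

theorem extend_fin (v : EuclideanSpace ℝ (Fin n)) (r : Fin n) : extend v (r : ℕ) = v r := by
  simpa using extend_add v r 0

theorem extend_lineMap (u v : EuclideanSpace ℝ (Fin n)) (s : ℝ) (x : ℤ) :
    extend ((1 - s) • u + s • v) x = (1 - s) * extend u x + s * extend v x := by
  obtain ⟨r, q, rfl⟩ := exists_fin_add_mul n x
  rw [extend_add, extend_add, extend_add]
  simp only [PiLp.add_apply, PiLp.smul_apply, smul_eq_mul]
  ring

/-- The simple roots compare neighbours inside one period; the condition on the highest root is the
comparison across the boundary between periods. -/
theorem mem_A₀ {v : V n} : v ∈ A₀ n ↔ ∀ x : ℤ, extend v.1 (x + 1) ≤ extend v.1 x := by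
  have hn := Nat.pos_of_neZero n
  constructor
  · rintro ⟨h1, h2⟩ x
    obtain ⟨r, q, rfl⟩ := exists_fin_add_mul n x
    by_cases hr : (r : ℕ) + 1 < n
    · have h := Set.mem_iInter₂.1 h1 (root r ⟨r + 1, hr⟩) ⟨r, _, rfl, rfl⟩
      rw [halfPos, Set.mem_ofPred_eq, inner_root] at h
      have e := extend_add v.1 ⟨r + 1, hr⟩ q
      rw [show (((⟨r + 1, hr⟩ : Fin n) : ℕ) : ℤ) + q * n = (r : ℕ) + q * n + 1 by
        push_cast; ring] at e
      rw [e, extend_add]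
      push_cast at h
      linarith
    · rw [halfNeg, Set.mem_ofPred_eq, highestRoot, inner_root] at h2
      have e := extend_add v.1 0 (q + 1)
      rw [show ((((0 : Fin n) : ℕ) : ℤ)) + (q + 1) * n = (r : ℕ) + q * n + 1 by
        have := r.2
        rw [Fin.val_zero, add_mul]; omega] at e
      have hr' : r = ⟨n - 1, Nat.sub_lt hn one_pos⟩ := Fin.ext (by have := r.2; simp only; omega)
      rw [e, extend_add, hr']
      push_cast at h2 ⊢
      linarith
  · intro h
    refine ⟨Set.mem_iInter₂.2 ?_, ?_⟩
    · rintro _ ⟨i, j, hij, rfl⟩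
      rw [halfPos, Set.mem_ofPred_eq, inner_root, ← extend_fin, ← extend_fin, hij]
      have := h (i : ℕ)
      push_cast
      linarith
    · rw [halfNeg, Set.mem_ofPred_eq, highestRoot, inner_root, ← extend_fin, ← extend_fin]
      have h1 := h ((n - 1 : ℕ) : ℤ)
      rw [show (((n - 1 : ℕ) : ℤ)) + 1 = ((0 : Fin n) : ℕ) + 1 * n by
        rw [Fin.val_zero]; omega, extend_add_mul] at h1
      push_cast at h1 ⊢
      linarith

theorem mem_smul_A₀ {w : AffineSymm n} {v : V n} :
    v ∈ w • A₀ n ↔ ∀ x : ℤ, extend v.1 (w.1 (x + 1)) ≤ extend v.1 (w.1 x) := by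
  rw [Set.mem_smul_set_iff_inv_smul_mem, mem_A₀]
  have h : ∀ x, extend (w⁻¹ • v).1 x = extend v.1 (w.1 x) := fun x => by
    change extend (actVec w⁻¹ v.1) x = _
    rw [extend_actVec, inv_inv]
  simp only [h]

/-- The interior of the alcove `w A₀` (see `interior_smul_A₀`). -/
def openAlcove (w : AffineSymm n) : Set (V n) :=
  {v | ∀ x : ℤ, extend v.1 (w.1 (x + 1)) < extend v.1 (w.1 x)}

theorem mem_openAlcove_of_fin {w : AffineSymm n} {v : V n}
    (h : ∀ r : Fin n, extend v.1 (w.1 ((r : ℕ) + 1)) < extend v.1 (w.1 (r : ℕ))) :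
    v ∈ openAlcove w := by
  intro x
  obtain ⟨r, q, rfl⟩ := exists_fin_add_mul n x
  rw [add_right_comm, apply_add_mul, apply_add_mul, extend_add_mul, extend_add_mul]
  have := h r
  linarith

theorem continuous_extend (x : ℤ) : Continuous fun v : V n => extend v.1 x := by
  unfold extend
  fun_prop

theorem isOpen_openAlcove (w : AffineSymm n) : IsOpen (openAlcove w) := by
  have : openAlcove w = ⋂ r : Fin n,
      {v : V n | extend v.1 (w.1 ((r : ℕ) + 1)) < extend v.1 (w.1 (r : ℕ))} := by
    ext v
    rw [Set.mem_iInter]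
    exact ⟨fun h r => h _, mem_openAlcove_of_fin⟩
  rw [this]
  exact isOpen_iInter_of_finite fun r => isOpen_lt (continuous_extend _) (continuous_extend _)

theorem interior_smul_A₀ (hn : 2 ≤ n) (w : AffineSymm n) : interior (w • A₀ n) = openAlcove w := by
  apply Set.Subset.antisymm
  · intro v hv x
    obtain ⟨a, b, p, q, ha, hb, -, h⟩ := exists_adjacent w x
    have hab : a ≠ b := by
      rintro rfl
      exact not_dvd_one hn ⟨q - p, by linarith⟩
    -- Moving an interior point slightly along `-(ε_a - ε_b)` narrows the gap in question while
    -- staying in the alcove, so the gap was positive.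
    have hc : Filter.Tendsto (fun s : ℝ => v - s • root a b) (nhds 0)
        (nhds (v - (0 : ℝ) • root a b)) := by
      apply Continuous.tendsto
      fun_prop
    rw [zero_smul, sub_zero] at hc
    have he := hc.eventually (mem_interior_iff_mem_nhds.1 hv)
    obtain ⟨s, hs, hs0⟩ := ((he.filter_mono nhdsWithin_le_nhds).and
      (self_mem_nhdsWithin (s := Set.Ioi (0 : ℝ)))).exists
    have h1 := mem_smul_A₀.1 hs x
    rw [ha, hb, extend_add, extend_add] at h1 ⊢
    have ea : (v - s • root a b).1 a = v.1 a - s := by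
      simp [root, hab]
    have eb : (v - s • root a b).1 b = v.1 b + s := by
      simp [root, hab.symm]
    rw [ea, eb] at h1
    have : 0 < s := hs0
    linarith
  · exact interior_maximal (fun v hv => mem_smul_A₀.2 fun x => (hv x).le) (isOpen_openAlcove w)

theorem strictAnti_of_mem_openAlcove {w : AffineSymm n} {v : V n} (hv : v ∈ openAlcove w) :
    StrictAnti fun x : ℤ => extend v.1 (w.1 x) :=
  strictAnti_int_of_succ_lt hv

theorem antitone_of_mem_smul_A₀ {w : AffineSymm n} {v : V n} (hv : v ∈ w • A₀ n) :
    Antitone fun x : ℤ => extend v.1 (w.1 x) :=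
  antitone_int_of_succ_le (mem_smul_A₀.1 hv)

/-- On the open alcove of `w`, the hyperplane `H_{ε_i - ε_j,k}` is below if `k` is at most the
position of `w` in the direction `ε_i - ε_j`, and above otherwise. -/
theorem openAlcove_side {w : AffineSymm n} {v : V n} (hv : v ∈ openAlcove w) {i j : Fin n}
    (hij : i ≠ j) (k : ℤ) :
    (k ≤ shiCoord w i j → (k : ℝ) < v.1 i - v.1 j) ∧
    (¬ k ≤ shiCoord w i j → v.1 i - v.1 j < k) := by
  have hanti := strictAnti_of_mem_openAlcove hv
  have h' := hanti.lt_iff_gt (a := (w⁻¹).1 (i : ℕ) + k * n) (b := (w⁻¹).1 (j : ℕ))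
  have h := hanti.lt_iff_gt (b := (w⁻¹).1 (i : ℕ) + k * n) (a := (w⁻¹).1 (j : ℕ))
  have hne := pos_ne w hij k
  simp only [apply_add_mul, apply_inv_apply, extend_add, extend_fin] at h h'
  rw [le_shiCoord]
  constructor
  · intro hle
    have := h.2 (lt_of_le_of_ne hle hne)
    linarith
  · intro hle
    have := h'.2 (not_le.1 hle)
    linarith

/-- An explicit point of the open alcove of `w`. -/
noncomputable def basePoint (w : AffineSymm n) : V n :=
  ⟨WithLp.toLp 2 fun i : Fin n => (∑ l : Fin n, ((l : ℕ) : ℝ)) / n ^ 2 -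
      ((w⁻¹).1 ((i : ℕ) : ℤ) : ℝ) / n, by
    -- Because the `w⁻¹ i` have the sum of the `i`, the constant is the average of the `w⁻¹ i / n`,
    -- and the coordinates sum to `0`.
    have hs : (∑ i : Fin n, (((w⁻¹ : AffineSymm n).1 ((i : ℕ) : ℤ) : ℤ) : ℝ)) =
        ∑ i : Fin n, ((i : ℕ) : ℝ) := by exact_mod_cast (w⁻¹).2.2
    have hn : (n : ℝ) ≠ 0 := by exact_mod_cast NeZero.ne n
    change ∑ i : Fin n, _ = (0 : ℝ)
    simp only [Finset.sum_sub_distrib, ← Finset.sum_div, hs]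
    rw [Finset.sum_const, Finset.card_univ, Fintype.card_fin, nsmul_eq_mul]
    field_simp
    ring⟩

theorem extend_basePoint (w : AffineSymm n) (x : ℤ) : extend (basePoint w).1 x =
    (∑ l : Fin n, ((l : ℕ) : ℝ)) / n ^ 2 - ((w⁻¹).1 x : ℝ) / n := by
  obtain ⟨r, q, rfl⟩ := exists_fin_add_mul n x
  have hn : (n : ℝ) ≠ 0 := by exact_mod_cast NeZero.ne n
  rw [extend_add, apply_add_mul]
  simp only [basePoint]
  push_cast
  field_simp
  ring

theorem basePoint_mem (w : AffineSymm n) : basePoint w ∈ openAlcove w := by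
  intro x
  have hn : (0 : ℝ) < n := by exact_mod_cast Nat.pos_of_neZero n
  rw [extend_basePoint, extend_basePoint, inv_apply_apply, inv_apply_apply]
  have : ((x : ℤ) : ℝ) / n < ((x + 1 : ℤ) : ℝ) / n := by
    apply div_lt_div_of_pos_right _ hn
    push_cast; linarith
  linarith

theorem mem_smul_of_mem_openAlcove {w : AffineSymm n} {v : V n} (hv : v ∈ openAlcove w) :
    v ∈ w • A₀ n :=
  mem_smul_A₀.2 fun x => (hv x).le

/-! ### Regions and minimal alcoves -/

/-- The alcoves of `u` and `w` lie on the same side of each hyperplane of the `m`-Shi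
arrangement. -/
def SameRegion (m : ℕ) (u w : AffineSymm n) : Prop :=
  ∀ i j : Fin n, i < j → ∀ k : ℤ, -(m : ℤ) < k → k ≤ m →
    (k ≤ shiCoord u i j ↔ k ≤ shiCoord w i j)

theorem notMem_shiArrangement {n m : ℕ} {v : V n} : v ∈ (⋃₀ shiArrangement n m)ᶜ ↔
    ∀ i j : Fin n, i < j → ∀ k : ℤ, -(m : ℤ) < k → k ≤ m → v.1 i - v.1 j ≠ k := by
  constructor
  · intro h i j hij k h1 h2 e
    exact h ⟨_, ⟨i, j, hij, k, h1, h2, rfl⟩, mem_hyperplane.2 e⟩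
  · rintro h ⟨_, ⟨i, j, hij, k, h1, h2, rfl⟩, e⟩
    exact h i j hij k h1 h2 (mem_hyperplane.1 e)

theorem continuous_coord_sub {n : ℕ} (i j : Fin n) : Continuous fun v : V n => v.1 i - v.1 j := by
  fun_prop

/-- By the intermediate value theorem, a connected set meeting both sides of a hyperplane meets the
hyperplane. -/
theorem sameRegion_of_mem {m : ℕ} {u w : AffineSymm n} {p q v : V n} (hp : p ∈ openAlcove u)
    (hq : q ∈ openAlcove w) (hpR : p ∈ connectedComponentIn (⋃₀ shiArrangement n m)ᶜ v)
    (hqR : q ∈ connectedComponentIn (⋃₀ shiArrangement n m)ᶜ v) {i j : Fin n} (hij : i < j)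
    {k : ℤ} (h1 : -(m : ℤ) < k) (h2 : k ≤ m) (h : k ≤ shiCoord u i j) : k ≤ shiCoord w i j := by
  by_contra hc
  have hpk := (openAlcove_side hp hij.ne k).1 h
  have hqk := (openAlcove_side hq hij.ne k).2 hc
  obtain ⟨x, hx, hxk⟩ := isPreconnected_connectedComponentIn.intermediate_value hqR hpR
    (continuous_coord_sub i j).continuousOn ⟨hqk.le, hpk.le⟩
  exact notMem_shiArrangement.1 (connectedComponentIn_subset _ _ hx) i j hij k h1 h2 hxk

/-- Each open side of a hyperplane is convex, so agreement on all sides keeps the segment off the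
arrangement. -/
theorem segment_subset_compl {m : ℕ} {u w : AffineSymm n} {p q : V n} (hp : p ∈ openAlcove u)
    (hq : q ∈ openAlcove w) (h : SameRegion m u w) :
    segment ℝ p q ⊆ (⋃₀ shiArrangement n m)ᶜ := by
  rintro _ ⟨s, t, hs, ht, hst, rfl⟩
  rw [notMem_shiArrangement]
  intro i j hij k h1 h2 e
  have hpk := openAlcove_side hp hij.ne k
  have hqk := openAlcove_side hq hij.ne k
  have e' : s * (p.1 i - p.1 j - k) + t * (q.1 i - q.1 j - k) = 0 := by
    have h3 : (s • p + t • q).1 i = s * p.1 i + t * q.1 i := rfl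
    have h4 : (s • p + t • q).1 j = s * p.1 j + t * q.1 j := rfl
    rw [h3, h4] at e
    have : (k : ℝ) = (s + t) * k := by rw [hst, one_mul]
    linarith
  by_cases hk : k ≤ shiCoord u i j
  · have a := hpk.1 hk
    have b := hqk.1 ((h i j hij k h1 h2).1 hk)
    rcases hs.eq_or_lt with rfl | hs
    · have : t = 1 := by linarith
      subst this
      linarith
    · nlinarith [mul_pos hs (sub_pos.2 a), mul_nonneg ht (sub_pos.2 b).le]
  · have a := hpk.2 hk
    have b := hqk.2 fun hk' => hk ((h i j hij k h1 h2).2 hk')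
    rcases hs.eq_or_lt with rfl | hs
    · have : t = 1 := by linarith
      subst this
      linarith
    · nlinarith [mul_pos hs (sub_pos.2 a), mul_nonneg ht (sub_pos.2 b).le]

theorem openAlcove_subset_component {m : ℕ} {u w : AffineSymm n} {p : V n}
    (hp : p ∈ openAlcove u) (h : SameRegion m u w) :
    openAlcove w ⊆ connectedComponentIn (⋃₀ shiArrangement n m)ᶜ p := fun q hq =>
  (convex_segment p q).isPreconnected.subset_connectedComponentIn (left_mem_segment ℝ p q)
    (segment_subset_compl hp hq h) (right_mem_segment ℝ p q)

theorem isMinimalAlcove_iff (hn : 2 ≤ n) (m : ℕ) (w : AffineSymm n) :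
    IsMinimalAlcove m w ↔ ∀ u, SameRegion m w u → sepCount w ≤ sepCount u := by
  have hw := basePoint_mem w
  constructor
  · rintro ⟨_, ⟨v, hv, rfl⟩, hsub, hmin⟩ u hu
    rw [← affLength_eq hn, ← affLength_eq hn]
    apply hmin
    rw [interior_smul_A₀ hn] at hsub ⊢
    rw [connectedComponentIn_eq (hsub hw)]
    exact openAlcove_subset_component hw hu
  · intro h
    refine ⟨_, ⟨basePoint w, segment_subset_compl hw hw (fun _ _ _ _ _ _ => Iff.rfl)
      (left_mem_segment ℝ _ _), rfl⟩, ?_, ?_⟩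
    · rw [interior_smul_A₀ hn]
      exact openAlcove_subset_component hw fun _ _ _ _ _ _ => Iff.rfl
    · intro u hu
      rw [interior_smul_A₀ hn] at hu
      rw [affLength_eq hn, affLength_eq hn]
      have hwR := openAlcove_subset_component (m := m) hw (fun _ _ _ _ _ _ => Iff.rfl) hw
      have huR := hu (basePoint_mem u)
      exact h u fun i j hij k h1 h2 =>
        ⟨sameRegion_of_mem hw (basePoint_mem u) hwR huR hij h1 h2,
          sameRegion_of_mem (basePoint_mem u) hw huR hwR hij h1 h2⟩

/-! ### Dominance and floors -/

theorem zero_le_shiCoord_of_isDominant {w : AffineSymm n} (h : IsDominant w) {i j : Fin n}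
    (hij : i < j) : 0 ≤ shiCoord w i j := by
  have hv := basePoint_mem w
  have hd := h (mem_smul_of_mem_openAlcove hv)
  have hle : ∀ d : ℕ, ∀ i j : Fin n, (j : ℕ) = i + d → (basePoint w).1 j ≤ (basePoint w).1 i := by
    intro d
    induction d with
    | zero =>
      intro i j e
      rw [Fin.ext e]
    | succ d ih =>
      intro i j e
      have hlt : (i : ℕ) + d < n := by have := j.2; omega
      have h1 := ih i ⟨i + d, hlt⟩ rfl
      have h2 := Set.mem_iInter₂.1 hd (root ⟨i + d, hlt⟩ j) ⟨_, j, e, rfl⟩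
      rw [halfPos, Set.mem_ofPred_eq, inner_root] at h2
      push_cast at h2
      linarith
  by_contra hc
  have h1 := (openAlcove_side hv hij.ne 0).2 hc
  have hij' : (i : ℕ) ≤ j := hij.le
  have h2 := hle (j - i) i j (by omega)
  push_cast at h1
  linarith

/-! ### Floors as pairs of adjacent positions. -/

theorem affineSpan_coord_sub {n : ℕ} {s : Set (V n)} {i j : Fin n} {c : ℝ}
    (h : ∀ v ∈ s, v.1 i - v.1 j = c) {v : V n} (hv : v ∈ affineSpan ℝ s) : v.1 i - v.1 j = c := by
  refine affineSpan_induction (p := fun v : V n => v.1 i - v.1 j = c) hv h ?_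
  intro t u v w hu hv hw
  have e : ∀ i, (t • (u -ᵥ v) +ᵥ w).1 i = t * (u.1 i - v.1 i) + w.1 i := fun _ => rfl
  rw [e, e]
  linear_combination t * hu - t * hv + hw

theorem exists_mem_hyperplane {n : ℕ} {a b : Fin n} (hab : a ≠ b) (k : ℤ) :
    ∃ v, v ∈ hyperplane (root a b) k := by
  refine ⟨((k : ℝ) / 2) • root a b, mem_hyperplane.2 ?_⟩
  simp [root, hab, hab.symm]

/-- If some `c + l n` followed `a + k n` before `b`, its entry would be squeezed between two values
that agree on the facet. This imposes a further linear equation on the affine span, which is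
therefore not the whole hyperplane. -/
theorem adjacent_of_isFloor (hn : 2 ≤ n) {w : AffineSymm n} {a b : Fin n} (hab : a ≠ b) {k : ℤ}
    (hk : 0 < k) (h : IsFloor (root a b) k (w • A₀ n)) :
    (w⁻¹).1 (b : ℕ) = (w⁻¹).1 (a : ℕ) + k * n + 1 := by
  obtain ⟨hw, -, ⟨hpos, -⟩ | ⟨-, hneg⟩⟩ := h
  swap
  · rw [halfPos, Set.mem_ofPred_eq, inner_zero_left] at hneg
    have : k ≤ 0 := by exact_mod_cast hneg
    omega
  have hv := basePoint_mem w
  have hle : (w⁻¹).1 (a : ℕ) + k * n ≤ (w⁻¹).1 (b : ℕ) := by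
    rw [← le_shiCoord]
    by_contra hc
    have h1 := (openAlcove_side hv hab k).2 hc
    have h2 := hpos (mem_smul_of_mem_openAlcove hv)
    rw [halfPos, Set.mem_ofPred_eq, inner_root] at h2
    linarith
  have hne := pos_ne w hab k
  by_contra hc
  obtain ⟨c, l, hcl⟩ := exists_fin_add_mul n (w.1 ((w⁻¹).1 (a : ℕ) + k * n + 1))
  have hca : c ≠ a := by
    rintro rfl
    have := congrArg (w⁻¹).1 hcl
    rw [inv_apply_apply, apply_add_mul] at this
    exact not_dvd_one hn ⟨l - k, by linarith⟩
  have hlb : c = b → l ≠ 0 := by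
    rintro rfl rfl
    have := congrArg (w⁻¹).1 hcl
    rw [inv_apply_apply, zero_mul, add_zero] at this
    exact hc this.symm
  have key : ∀ v ∈ w • A₀ n ∩ hyperplane (root a b) k, v.1 a - v.1 c = (k : ℝ) - l := by
    rintro v ⟨hvA, hvH⟩
    have hanti := antitone_of_mem_smul_A₀ hvA
    have h1 := hanti (show (w⁻¹).1 (a : ℕ) + k * n ≤ (w⁻¹).1 (a : ℕ) + k * n + 1 by omega)
    have h2 := hanti (show (w⁻¹).1 (a : ℕ) + k * n + 1 ≤ (w⁻¹).1 (b : ℕ) by omega)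
    simp only [hcl, apply_inv_apply, extend_add, extend_fin] at h1 h2
    rw [apply_add_mul, apply_inv_apply, extend_add] at h1
    have h3 := mem_hyperplane.1 hvH
    linarith
  have key' : ∀ v ∈ hyperplane (root a b) k, v.1 a - v.1 c = (k : ℝ) - l := by
    intro v hv
    rw [← hw] at hv
    exact affineSpan_coord_sub key hv
  obtain ⟨v, hv⟩ := exists_mem_hyperplane hab k
  have h1 := key' v hv
  by_cases hcb : c = b
  · subst hcb
    have h2 := mem_hyperplane.1 hv
    apply hlb rfl
    have : (l : ℝ) = 0 := by linarith
    exact_mod_cast this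
  -- This shift preserves `v_a - v_b` but raises `v_a - v_c` by `3`.
  · have hv' : v + root a c + root b c ∈ hyperplane (root a b) k := by
      rw [mem_hyperplane] at hv ⊢
      simp only [Submodule.coe_add, root, PiLp.add_apply, PiLp.sub_apply]
      simp [hab, hab.symm, hca.symm, Ne.symm hcb]
      linarith
    have h2 := key' _ hv'
    simp only [Submodule.coe_add, root, PiLp.add_apply, PiLp.sub_apply] at h2
    simp [hab, hca, hca.symm, hcb] at h2
    linarith

/-- A point of the wall of `w A₀` at an adjacent pair of positions that lies on no other wall. -/
theorem exists_wall_point (hn : 2 ≤ n) {w : AffineSymm n} {a b : Fin n} {k : ℤ}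
    (h : (w⁻¹).1 (b : ℕ) = (w⁻¹).1 (a : ℕ) + k * n + 1) :
    ∃ z : V n, z ∈ hyperplane (root a b) k ∧ ∀ x : ℤ, (∀ q : ℤ, x ≠ (w⁻¹).1 (a : ℕ) + q * n) →
      1 / (2 * n : ℝ) ≤ extend z.1 (w.1 x) - extend z.1 (w.1 (x + 1)) := by
  set t := (w⁻¹).1 (a : ℕ) with ht
  set w' := w * adjSwap hn t with hw'
  -- The midpoint of the base points of the two alcoves sharing this wall.
  set z : V n := (1 - (1 / 2 : ℝ)) • basePoint w + (1 / 2 : ℝ) • basePoint w' with hz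
  have hn0 : (0 : ℝ) < n := by exact_mod_cast Nat.pos_of_neZero n
  have hinv : ∀ x, (w'⁻¹).1 x = (adjSwap hn t).1 ((w⁻¹).1 x) := by
    intro x
    rw [hw', mul_inv_rev, adjSwap_inv]
    rfl
  have hext : ∀ x, extend z.1 x = (∑ l : Fin n, ((l : ℕ) : ℝ)) / n ^ 2 -
      (((w⁻¹).1 x + (adjSwap hn t).1 ((w⁻¹).1 x) : ℤ) : ℝ) / (2 * n) := by
    intro x
    have := extend_lineMap (basePoint w).1 (basePoint w').1 (1 / 2) x
    rw [extend_basePoint, extend_basePoint, hinv] at this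
    refine Eq.trans this ?_
    push_cast
    field_simp
    ring
  refine ⟨z, ?_, ?_⟩
  · rw [mem_hyperplane, ← extend_fin, ← extend_fin, hext, hext, h, ← ht,
      show t + k * n + 1 = t + 1 + k * n by ring, adjSwap_apply_right]
    have := adjSwap_apply_left hn t 0
    rw [zero_mul, add_zero, add_zero] at this
    rw [this]
    push_cast
    field_simp
    ring
  · intro x hx
    rw [hext, hext, inv_apply_apply, inv_apply_apply]
    -- The swap reverses no consecutive pair other than the translates of `t, t + 1`.
    have hmono : x + (adjSwap hn t).1 x + 1 ≤ x + 1 + (adjSwap hn t).1 (x + 1) := by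
      by_cases h1 : ∃ q : ℤ, x = t + 1 + q * n
      · obtain ⟨q, hq⟩ := h1
        have e1 : (adjSwap hn t).1 x = x - 1 := by
          rw [hq, adjSwap_apply_right]; ring
        by_cases h2 : ∃ q : ℤ, x + 1 = t + q * n
        · obtain ⟨q', hq'⟩ := h2
          have e2 : (adjSwap hn t).1 (x + 1) = x + 2 := by
            rw [hq', adjSwap_apply_left]; linarith
          rw [e1, e2]; omega
        · push Not at h2
          rw [e1, adjSwap_apply_of_ne hn h2 fun q e => hx q (by linarith)]; omega
      · push Not at h1
        rw [adjSwap_apply_of_ne hn hx h1]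
        by_cases h2 : ∃ q : ℤ, x + 1 = t + q * n
        · obtain ⟨q', hq'⟩ := h2
          have e2 : (adjSwap hn t).1 (x + 1) = x + 2 := by
            rw [hq', adjSwap_apply_left]; linarith
          rw [e2]; omega
        · push Not at h2
          rw [adjSwap_apply_of_ne hn h2 fun q e => hx q (by linarith)]; omega
    have hmono' : ((x + (adjSwap hn t).1 x : ℤ) : ℝ) + 1 ≤
        ((x + 1 + (adjSwap hn t).1 (x + 1) : ℤ) : ℝ) := by exact_mod_cast hmono
    have h2n : (0 : ℝ) < 2 * n := by positivity
    have := div_le_div_of_nonneg_right hmono' h2n.le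
    rw [add_div] at this
    linarith

theorem isFloor_of_adjacent (hn : 2 ≤ n) {w : AffineSymm n} {a b : Fin n} {k : ℤ} (hk : 0 < k)
    (h : (w⁻¹).1 (b : ℕ) = (w⁻¹).1 (a : ℕ) + k * n + 1) :
    IsFloor (root a b) k (w • A₀ n) := by
  have hn0 : (0 : ℝ) < n := by exact_mod_cast Nat.pos_of_neZero n
  have hk' : (0 : ℝ) < k := by exact_mod_cast hk
  refine ⟨?_, ?_, Or.inl ⟨?_, ?_⟩⟩
  · apply Set.Subset.antisymm
    · intro v hv
      rw [mem_hyperplane]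
      exact affineSpan_coord_sub (fun v hv => mem_hyperplane.1 hv.2) hv
    · intro v hv
      obtain ⟨z, hzH, hz⟩ := exists_wall_point hn h
      obtain ⟨M, hM⟩ := Finite.exists_le fun r : Fin n =>
        extend v.1 (w.1 ((r : ℕ) + 1)) - extend v.1 (w.1 (r : ℕ))
      have hM' : ∀ x : ℤ, extend v.1 (w.1 (x + 1)) - extend v.1 (w.1 x) ≤ max M 0 := by
        intro x
        obtain ⟨r, q, rfl⟩ := exists_fin_add_mul n x
        rw [add_right_comm, apply_add_mul, apply_add_mul, extend_add_mul, extend_add_mul]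
        have := hM r
        have := le_max_left M 0
        linarith
      set N := max M 0
      have hN : 0 ≤ N := le_max_right _ _
      -- Chosen so that `s N = (1 - s) / (2 n)`: the gaps of `z` absorb those of `v`, and the point
      -- a fraction `s` of the way from `z` to `v` stays in the alcove. The line through it and `z`
      -- then reaches `v`.
      set s : ℝ := 1 / (1 + 2 * n * N) with hs
      have hden : 0 < 1 + 2 * n * N := by positivity
      have hs0 : 0 < s := by positivity
      have hsN : s * N ≤ (1 - s) * (1 / (2 * n)) := by
        rw [hs]
        field_simp
        linarith
      have hs1 : 0 ≤ 1 - s := by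
        have : s ≤ 1 := by
          rw [hs, div_le_one hden]
          nlinarith [mul_nonneg hn0.le hN]
        linarith
      have hlin : ∀ u ∈ hyperplane (root a b) k, ∀ q : ℤ,
          extend u.1 (w.1 ((w⁻¹).1 (a : ℕ) + q * n)) =
            extend u.1 (w.1 ((w⁻¹).1 (a : ℕ) + q * n + 1)) := by
        intro u hu q
        have e : (w⁻¹).1 (a : ℕ) + q * n + 1 = (w⁻¹).1 (b : ℕ) + (q - k) * n := by rw [h]; ring
        rw [e, apply_add_mul, apply_add_mul, apply_inv_apply, apply_inv_apply, extend_add,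
          extend_add]
        have := mem_hyperplane.1 hu
        push_cast
        linarith
      have hyH : (1 - s) • z + s • v ∈ hyperplane (root a b) k := by
        rw [mem_hyperplane] at *
        have e : ∀ i, ((1 - s) • z + s • v).1 i = (1 - s) * z.1 i + s * v.1 i := fun _ => rfl
        rw [e, e]
        linear_combination (1 - s) * hzH + s * hv
      have hyA : (1 - s) • z + s • v ∈ w • A₀ n := by
        rw [mem_smul_A₀]
        intro x
        by_cases hx : ∃ q : ℤ, x = (w⁻¹).1 (a : ℕ) + q * n
        · obtain ⟨q, rfl⟩ := hx
          exact (hlin _ hyH q).ge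
        · push Not at hx
          have e : ∀ x, extend ((1 - s) • z + s • v).1 x =
            (1 - s) * extend z.1 x + s * extend v.1 x := fun x => extend_lineMap _ _ s x
          rw [e, e]
          have h1 := mul_le_mul_of_nonneg_left (hz x hx) hs1
          have h2 := mul_le_mul_of_nonneg_left (hM' x) hs0.le
          linarith
      have hzA : z ∈ w • A₀ n := by
        rw [mem_smul_A₀]
        intro x
        by_cases hx : ∃ q : ℤ, x = (w⁻¹).1 (a : ℕ) + q * n
        · obtain ⟨q, rfl⟩ := hx
          exact (hlin _ hzH q).ge
        · push Not at hx
          have h1 := hz x hx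
          have : (0 : ℝ) ≤ 1 / (2 * n) := by positivity
          linarith
      have hline := AffineMap.lineMap_mem (k := ℝ) s⁻¹
        (subset_affineSpan ℝ (w • A₀ n ∩ hyperplane (root a b) k) ⟨hzA, hzH⟩)
        (subset_affineSpan ℝ (w • A₀ n ∩ hyperplane (root a b) k) ⟨hyA, hyH⟩)
      have e : AffineMap.lineMap z ((1 - s) • z + s • v) s⁻¹ = v := by
        rw [AffineMap.lineMap_apply_module]
        rw [smul_add, smul_smul, smul_smul, inv_mul_cancel₀ hs0.ne', one_smul, ← add_assoc,
          ← add_smul]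
        have : (1 - s⁻¹ + s⁻¹ * (1 - s)) = 0 := by field_simp; ring
        rw [this, zero_smul, zero_add]
      rw [e] at hline
      exact hline
  · rw [hyperplane, Set.mem_ofPred_eq, inner_zero_left]
    exact hk'.ne
  · intro v hv
    rw [halfPos, Set.mem_ofPred_eq, inner_root]
    have h1 := antitone_of_mem_smul_A₀ hv
      (show (w⁻¹).1 (a : ℕ) + k * n ≤ (w⁻¹).1 (b : ℕ) by omega)
    simp only [apply_add_mul, apply_inv_apply, extend_add, extend_fin] at h1
    linarith
  · rw [halfNeg, Set.mem_ofPred_eq, inner_zero_left]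
    exact hk'.le

/-! ### Minimality of dominant alcoves and of their translates under `Sₙ` -/

theorem sepCount_le_of_natAbs_le {u w : AffineSymm n}
    (h : ∀ i j, i ≠ j → (shiCoord u i j).natAbs ≤ (shiCoord w i j).natAbs) :
    sepCount u ≤ sepCount w :=
  Finset.sum_le_sum fun e he => h e.1 e.2 (by simpa using (Finset.mem_filter.1 he).2.ne)

/-- If `H_{ε_a-ε_b,k}`, `k > 0`, is a floor of `w A₀` and `ρ w A₀` is `m`-minimal, then
`ρ` maps it to a hyperplane of the `m`-Shi arrangement. -/
theorem le_of_adjacent (hn : 2 ≤ n) {m : ℕ} {w : AffineSymm n}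
    {ρ : Equiv.Perm (Fin n)} (hmin : IsMinimalAlcove m (finEmbed n ρ * w)) {a b : Fin n}
    {k : ℤ} (hk : 0 < k) (h : (w⁻¹).1 (b : ℕ) = (w⁻¹).1 (a : ℕ) + k * n + 1) :
    k ≤ m ∧ (k = m → ρ a < ρ b) := by
  obtain ⟨hab, h1, h2, h3⟩ := shiCoord_mul_adjSwap hn w h
  set s := adjSwap hn ((w⁻¹).1 (a : ℕ)) with hs
  have h1' := shiCoord_swap w hab
  have h2' := shiCoord_swap (w * s) hab
  rw [h1] at h1'
  rw [h2] at h2'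
  -- For `k ≥ 1`, `ρ a + k n` exceeds `ρ b` whatever the order of `ρ a` and `ρ b`, so the crossing
  -- is always a descent.
  have hlt : sepCount (finEmbed n ρ * (w * s)) < sepCount (finEmbed n ρ * w) := by
    have hcast : ∀ c : Fin n, ((finEmbed n ρ * w)⁻¹).1 ((ρ c : Fin n) : ℕ) = (w⁻¹).1 (c : ℕ) := by
      intro c
      rw [mul_inv_rev, ← map_inv]
      change (w⁻¹).1 ((finEmbed n ρ⁻¹).1 ((ρ c : Fin n) : ℕ)) = _
      rw [finEmbed_apply_fin, show ρ⁻¹ (ρ c) = c from ρ.symm_apply_apply c]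
    have := (sepCount_mul_adjSwap hn (finEmbed n ρ * w) (a := ρ a) (b := ρ b) (k := k)
      (by rw [hcast, hcast, h])).2 (by
        have hnpos := natCast_pos_int n
        have : 1 * (n : ℤ) ≤ k * n := mul_le_mul_of_nonneg_right (by omega) hnpos.le
        have := (ρ b).2
        omega)
    rw [hcast, mul_assoc, ← hs] at this
    omega
  have hnot : ¬ SameRegion m (finEmbed n ρ * w) (finEmbed n ρ * (w * s)) := fun hc =>
    absurd ((isMinimalAlcove_iff hn m _).1 hmin _ hc) (not_le.2 hlt)
  by_contra hc
  apply hnot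
  intro i j hij l hl1 hl2
  rw [shiCoord_finEmbed_mul, shiCoord_finEmbed_mul]
  have hne : ρ⁻¹ i ≠ ρ⁻¹ j := fun e => hij.ne (ρ⁻¹.injective e)
  -- Only the level `l = k` distinguishes the two alcoves if `ρ a < ρ b`, and only `l = -k` if `ρ b
  -- < ρ a`; in the latter case `-m < l` excludes `k = m`.
  by_cases e1 : (ρ⁻¹ i, ρ⁻¹ j) = (a, b)
  · rw [Prod.mk.injEq] at e1
    rw [e1.1, e1.2, h1, h2]
    have hlt : ρ a < ρ b := by rw [← e1.1, ← e1.2]; simpa using hij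
    have : ¬ k ≤ m := fun hkm => hc ⟨hkm, fun _ => hlt⟩
    omega
  by_cases e2 : (ρ⁻¹ i, ρ⁻¹ j) = (b, a)
  · rw [Prod.mk.injEq] at e2
    rw [e2.1, e2.2, h1', h2']
    have : ¬ k < m := fun hkm => hc ⟨hkm.le, fun e => absurd e hkm.ne⟩
    omega
  · rw [h3 _ _ hne e1 e2]

/-- In a dominant alcove all of whose floors `H_{ε_a-ε_b,k}` satisfy `k ≤ M a b`, where `M` takes
the values `m - 1` and `m` only, a position exceeding `M i j` is a sum of two positions. -/
theorem exists_between {w : AffineSymm n} (hdom : ∀ i j : Fin n, i < j → 0 ≤ shiCoord w i j)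
    {m : ℤ} {M : Fin n → Fin n → ℤ} (hM : ∀ i j, m - 1 ≤ M i j ∧ M i j ≤ m) (hm : 1 ≤ m)
    (hfloor : ∀ a b : Fin n, a < b → ∀ k : ℤ, 0 < k →
      (w⁻¹).1 (b : ℕ) = (w⁻¹).1 (a : ℕ) + k * n + 1 → k ≤ M a b)
    {i j : Fin n} (hij : i < j) (hk : M i j < shiCoord w i j) :
    ∃ (c : Fin n) (l : ℤ), i < c ∧ c < j ∧ l ≤ shiCoord w c j ∧
      shiCoord w i j - l ≤ shiCoord w i c := by
  by_contra! hc
  have hnpos := natCast_pos_int n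
  have hg : ∀ i j : Fin n, i < j → (w⁻¹).1 (i : ℕ) < (w⁻¹).1 (j : ℕ) := by
    intro i j hij
    have h1 := (le_shiCoord w i j 0).1 (hdom i j hij)
    have h2 := pos_ne w hij.ne 0
    rw [zero_mul, add_zero] at h1 h2
    exact lt_of_le_of_ne h1 h2
  set k := shiCoord w i j with hkdef
  set p := (w⁻¹).1 (i : ℕ) + k * n with hp
  set q := (w⁻¹).1 (j : ℕ) with hq
  have hpq : p < q := lt_of_le_of_ne ((le_shiCoord w i j k).1 le_rfl) (pos_ne w hij.ne k)
  have hqp : q < p + n := by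
    by_contra hcon
    have := (le_shiCoord w i j (k + 1)).2 (by rw [add_mul]; omega)
    omega
  -- the residue at each position
  choose res quo hres using fun x => exists_fin_add_mul n (w.1 x)
  have hpos : ∀ x, x = (w⁻¹).1 ((res x : Fin n) : ℕ) + quo x * n := by
    intro x
    rw [← apply_add_mul, ← hres, inv_apply_apply]
  have hresq : res q = j ∧ quo q = 0 := by
    apply fin_add_mul_inj
    rw [← hres, hq, apply_inv_apply]; simp
  have hresp : res p = i ∧ quo p = k := by
    apply fin_add_mul_inj
    rw [← hres, hp, apply_add_mul, apply_inv_apply]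
  -- Here `p` and `q` are the places of `i + k n` and `j`. A residue strictly between `i` and `j`
  -- occurring between them would be the desired `c`; the residues `i` and `j` cannot recur because
  -- `q < p + n`.
  have hout : ∀ x, p < x → x < q → res x < i ∨ j < res x := by
    intro x hx1 hx2
    have hx := hpos x
    by_contra! hcon
    obtain ⟨h1, h2⟩ := hcon
    rcases h1.eq_or_lt with h1 | h1
    · rw [← h1] at hx
      have h3 : (quo x - k) * n < 1 * n := by rw [sub_mul]; omega
      have h4 : 0 * (n : ℤ) < (quo x - k) * n := by rw [sub_mul]; omega
      have h3 := lt_of_mul_lt_mul_right h3 hnpos.le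
      have h4 := lt_of_mul_lt_mul_right h4 hnpos.le
      omega
    rcases h2.eq_or_lt with h2 | h2
    · rw [h2] at hx
      have h3 : (quo x) * n < 0 * n := by omega
      have h4 : (-1) * (n : ℤ) < (quo x) * n := by omega
      have h3 := lt_of_mul_lt_mul_right h3 hnpos.le
      have h4 := lt_of_mul_lt_mul_right h4 hnpos.le
      omega
    · have h3 := hc (res x) (quo x) h1 h2 ((le_shiCoord w _ _ _).2 (by omega))
      rw [← not_le, le_shiCoord, sub_mul] at h3
      omega
  -- the first position after `p` with residue at least `j`
  obtain ⟨r, ⟨hr1, hr2, hr3⟩, hrmin⟩ : ∃ r : ℤ, (p < r ∧ r ≤ q ∧ j ≤ res r) ∧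
      ∀ z : ℤ, (p < z ∧ z ≤ q ∧ j ≤ res z) → r ≤ z :=
    Int.exists_least_of_bdd ⟨p, fun z hz => hz.1.le⟩ ⟨q, hpq, le_rfl, hresq.1.ge⟩
  -- Dominance lists smaller residues earlier within a period, so a residue below `i` found after
  -- `p` must carry a multiple of `n` larger than `k`; dually, one above `j` found before `q`
  -- carries a negative multiple.
  have hprev : res (r - 1) ≤ i ∧ k ≤ quo (r - 1) ∧ (res (r - 1) ≠ i → k < quo (r - 1)) := by
    rcases (show p ≤ r - 1 by omega).eq_or_lt with h | h
    · rw [← h]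
      exact ⟨hresp.1.le, hresp.2.ge, fun hne => absurd hresp.1 hne⟩
    · have hlt : res (r - 1) < i := by
        refine (hout (r - 1) h (by omega)).resolve_right fun hcon => ?_
        have := hrmin (r - 1) ⟨h, by omega, hcon.le⟩
        omega
      have h1 := hg _ _ hlt
      have h2 := hpos (r - 1)
      have h3 : k * n < quo (r - 1) * n := by omega
      have h3 := lt_of_mul_lt_mul_right h3 hnpos.le
      exact ⟨hlt.le, h3.le, fun _ => h3⟩
  have hnext : quo r ≤ 0 ∧ (res r ≠ j → quo r < 0) := by
    rcases hr2.eq_or_lt with h | h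
    · rw [h]
      exact ⟨hresq.2.le, fun hne => absurd hresq.1 hne⟩
    · have hlt : j < res r := (hout r hr1 h).resolve_left fun hcon =>
        absurd (hcon.trans hij) (not_lt.2 hr3)
      have h1 := hg _ _ hlt
      have h2 := hpos r
      have h3 : quo r * n < 0 * n := by omega
      have h3 := lt_of_mul_lt_mul_right h3 hnpos.le
      exact ⟨h3.le, fun _ => h3⟩
  obtain ⟨hp1, hp2, hp3⟩ := hprev
  obtain ⟨hn1, hn2⟩ := hnext
  have hMij := hM i j
  have hMr := hM (res (r - 1)) (res r)
  -- The step from `r - 1` to `r` is a floor. If its pair is `(i, j)`, its height is at least `k > M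
  -- i j`; otherwise it is at least `k + 1 > m`. Both contradict the bound.
  have hle := hfloor (res (r - 1)) (res r) (hp1.trans_lt (hij.trans_le hr3))
    (quo (r - 1) - quo r) (by omega) (by
      have h1 := hpos r
      have h2 := hpos (r - 1)
      rw [sub_mul]
      omega)
  by_cases e1 : res (r - 1) = i
  · by_cases e2 : res r = j
    · rw [e1, e2] at hle
      omega
    · have := hn2 e2
      omega
  · have := hp3 e1
    omega

/-- A dominant alcove all of whose floors `H_{ε_a-ε_b,k}` satisfy `k ≤ M a b` has minimal positions
among the dominant alcoves on the same side of the hyperplanes `H_{ε_i-ε_j,k}`, `k ≤ M i j`. -/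
theorem shiCoord_le {u w : AffineSymm n} (hdom : ∀ i j : Fin n, i < j → 0 ≤ shiCoord w i j)
    {m : ℤ} {M : Fin n → Fin n → ℤ} (hM : ∀ i j, m - 1 ≤ M i j ∧ M i j ≤ m) (hm : 1 ≤ m)
    (hfloor : ∀ a b : Fin n, a < b → ∀ k : ℤ, 0 < k →
      (w⁻¹).1 (b : ℕ) = (w⁻¹).1 (a : ℕ) + k * n + 1 → k ≤ M a b)
    (hu : ∀ i j : Fin n, i < j → ∀ k : ℤ, 0 ≤ k → k ≤ M i j → k ≤ shiCoord w i j →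
      k ≤ shiCoord u i j) :
    ∀ i j : Fin n, i < j → shiCoord w i j ≤ shiCoord u i j := by
  have main : ∀ d : ℕ, ∀ i j : Fin n, i < j → (j : ℕ) - i ≤ d →
      shiCoord w i j ≤ shiCoord u i j := by
    intro d
    induction d with
    | zero =>
      intro i j hij hd
      have : (i : ℕ) < j := hij
      omega
    | succ d ih =>
      intro i j hij hd
      rcases le_or_gt (shiCoord w i j) (M i j) with hle | hlt
      · exact hu i j hij _ (hdom i j hij) hle le_rfl
      · obtain ⟨c, l, hic, hcj, h1, h2⟩ := exists_between hdom hM hm hfloor hij hlt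
        have hic' : (i : ℕ) < c := hic
        have hcj' : (c : ℕ) < j := hcj
        -- The two lower bounds hold for `u` by induction, and they add up since `ε_i - ε_j = (ε_i -
        -- ε_c) + (ε_c - ε_j)`.
        have h3 := h1.trans (ih c j hcj (by omega))
        have h4 := h2.trans (ih i c hic (by omega))
        rw [le_shiCoord] at h3 h4 ⊢
        rw [sub_mul] at h4
        linarith
  exact fun i j hij => main _ i j hij le_rfl

theorem isMinimalAlcove_finEmbed_mul (hn : 2 ≤ n) {m : ℕ} (hm : 1 ≤ m) {w : AffineSymm n}
    (hdom : IsDominant w) (ρ : Equiv.Perm (Fin n))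
    (hfloor : ∀ a b : Fin n, a < b → ∀ k : ℤ, 0 < k →
      (w⁻¹).1 (b : ℕ) = (w⁻¹).1 (a : ℕ) + k * n + 1 → k ≤ m ∧ (k = m → ρ a < ρ b)) :
    IsMinimalAlcove m (finEmbed n ρ * w) := by
  rw [isMinimalAlcove_iff hn]
  intro u' hu'
  obtain ⟨u, rfl⟩ : ∃ u, u' = finEmbed n ρ * u := ⟨(finEmbed n ρ)⁻¹ * u', by group⟩
  have hd : ∀ i j : Fin n, i < j → 0 ≤ shiCoord w i j := fun i j =>
    zero_le_shiCoord_of_isDominant hdom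
  have hsame : ∀ a b : Fin n, ρ a < ρ b → ∀ k : ℤ, -(m : ℤ) < k → k ≤ m →
      (k ≤ shiCoord w a b ↔ k ≤ shiCoord u a b) := by
    intro a b hab k h1 h2
    have := hu' (ρ a) (ρ b) hab k h1 h2
    rw [shiCoord_finEmbed_mul, shiCoord_finEmbed_mul] at this
    simpa using this
  have hle : ∀ i j : Fin n, i < j → shiCoord w i j ≤ shiCoord u i j := by
    -- `M a b` is the highest level at which the arrangement, pulled back by `ρ`, contains a
    -- hyperplane in the direction `ε_a - ε_b`.
    refine shiCoord_le hd (m := m) (M := fun a b => if ρ a < ρ b then (m : ℤ) else m - 1)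
      (fun i j => by split_ifs <;> omega) (by exact_mod_cast hm) ?_ ?_
    · intro a b hab k hk h
      obtain ⟨h1, h2⟩ := hfloor a b hab k hk h
      split_ifs with hρ
      · exact h1
      · have : k ≠ m := fun e => hρ (h2 e)
        omega
    · intro a b hab k hk0 hkM hk
      split_ifs at hkM with hρ
      · exact (hsame a b hρ k (by omega) hkM).1 hk
      · have hρ' : ρ b < ρ a := lt_of_le_of_ne (not_lt.1 hρ) fun e => hab.ne' (ρ.injective e)
        have h1 := hsame b a hρ' (-k) (by omega) (by omega)
        rw [shiCoord_swap w hab.ne, shiCoord_swap u hab.ne] at h1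
        omega
  refine sepCount_le_of_natAbs_le fun i j hij => ?_
  rw [shiCoord_finEmbed_mul, shiCoord_finEmbed_mul]
  have hne : ρ⁻¹ i ≠ ρ⁻¹ j := fun e => hij (ρ⁻¹.injective e)
  generalize ρ⁻¹ i = a, ρ⁻¹ j = b at hne
  rcases lt_or_gt_of_ne hne with hab | hab
  · have := hd a b hab
    have := hle a b hab
    omega
  · rw [shiCoord_swap w hab.ne, shiCoord_swap u hab.ne]
    have := hd b a hab
    have := hle b a hab
    omega

end

end ShiArr

theorem mainTheorem3 (n m : ℕ) [NeZero n] (hn : 2 < n) (hm : 1 ≤ m)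
    (w : ShiArr.AffineSymm n) (hdom : ShiArr.IsDominant w) (hmin : ShiArr.IsMinimalAlcove m w)
    (ρ : Equiv.Perm (Fin n)) :
    ShiArr.IsMinimalAlcove m (ShiArr.finEmbed n ρ * w) ↔
      ρ ∈ ShiArr.ascentSet (ShiArr.floorTranspositions m w) := by
  have hm0 : (0 : ℤ) < m := by exact_mod_cast hm
  constructor
  · rintro h _ ⟨a, b, hab, hfl, rfl⟩
    rw [gt_iff_lt, ShiArr.finLength_lt_mul_swap_iff hn.le ρ hab]
    exact (ShiArr.le_of_adjacent hn.le h hm0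
      (ShiArr.adjacent_of_isFloor hn.le hab.ne hm0 hfl)).2 rfl
  · intro h
    refine ShiArr.isMinimalAlcove_finEmbed_mul hn.le hm hdom ρ fun a b hab k hk hadj => ?_
    -- Necessity for `ρ = 1` turns the minimality of `w A₀` into the bound `k ≤ m` on all floors.
    have hmin' : ShiArr.IsMinimalAlcove m (ShiArr.finEmbed n 1 * w) := by
      rwa [map_one, one_mul]
    refine ⟨(ShiArr.le_of_adjacent hn.le hmin' hk hadj).1, ?_⟩
    rintro rfl
    rw [← ShiArr.finLength_lt_mul_swap_iff hn.le ρ hab]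
    exact h _ ⟨a, b, hab, ShiArr.isFloor_of_adjacent hn.le hk hadj, rfl⟩
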